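/- Let $\mu$ be the probability measure $d\mu(t)=\frac{1}{2\pi}\frac{dt}{\frac14+t^2}$ on $\mathbb{R}$, and for $n\in\mathbb{Z}$ let $$e_n(t)=\left(\frac{\frac12-it}{\frac12+it}\right)^n .$$ Let $$\gamma_k=\lim_{N\to\infty}\left(\sum_{m=1}^N\frac{\log^k m}{m}-\frac{\log^{k+1}N}{k+1}\right)\qquad(k\ge 0)$$ be the Stieltjes constants (with $\log^0 m=1$), and put $\ell_0=\gamma_0-1$ and $$\ell_n=(-1)^n\sum_{k=1}^n\binom{n-1}{k-1}\frac{(-1)^k\gamma_k}{k!}\qquad(n\ge1).$$ Let $T:\mathbb{R}\to\mathbb{R}$ be the Boole transformation $Tx=\frac12\left(x-\frac1{4x}\right)$ for $x\neq0$, $T0=0$, and let $T^n$ denote its $n$-th iterate, with $T^0x=x$. **Theorem.** Let $g\in L^2(\mu)$ be complex-valued, with Fourier coefficients $a_m=\int_{\mathbb{R}}g\,\overline{e_m}\,d\mu$ $(m\in\mathbb{Z})$. Then the series $\sum_{m\ge0}\ell_m a_{-m}$ converges absolutely, and for (Lebesgue-)almost every real $x$, $$\lim_{N\to\infty}\frac1N\sum_{n=0}^{N-1}\zeta\left(\tfrac12+iT^nx\right)g(T^nx)=-a_1+\sum_{m\ge0}\ell_m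 a_{-m}.$$ -/

import Mathlib

open MeasureTheory ProbabilityTheory Filter Topology

namespace ZetaBoole

/-- The probability measure `μ(A) = (1 / 2π) ∫_A dt / (1/4 + t²)` on `ℝ`, that is, the Cauchy
distribution with location `0` and scale `1/2` (see `mu_apply`). -/
noncomputable def mu : Measure ℝ := cauchyMeasure 0 (1 / 2)

theorem mu_apply (A : Set ℝ) (hA : MeasurableSet A) :
    mu A = ∫⁻ t in A, ENNReal.ofReal (1 / (2 * Real.pi) * (1 / (1 / 4 + t ^ 2))) := by
  have h : (1 / 2 : NNReal) ≠ 0 := by norm_num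
  rw [mu, cauchyMeasure, if_neg h, withDensity_apply _ hA]
  refine lintegral_congr fun t => ?_
  rw [cauchyPDF, cauchyPDFReal_def]
  congr 1
  have h1 : (1 / 4 + t ^ 2) ≠ 0 := by positivity
  have h2 : ((t - 0) ^ 2 + ((1 / 2 : NNReal) : ℝ) ^ 2) = 1 / 4 + t ^ 2 := by
    push_cast; ring
  rw [h2]
  push_cast
  field_simp

/-- The orthonormal basis `e_n(t) = ((1/2 - it) / (1/2 + it))^n`, `n ∈ ℤ`, of `L²(μ)`. -/
noncomputable def e (n : ℤ) (t : ℝ) : ℂ :=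
  ((1 / 2 - Complex.I * t) / (1 / 2 + Complex.I * t)) ^ n

/-- The Fourier coefficient `⟨g, e_m⟩ = ∫ g conj(e_m) dμ`. -/
noncomputable def fourierCoefficient (g : ℝ → ℂ) (m : ℤ) : ℂ :=
  ∫ t, g t * (starRingEnd ℂ) (e m t) ∂mu

/-- The sequence whose limit is the `k`-th Stieltjes constant. -/
noncomputable def stieltjesSeq (k N : ℕ) : ℝ :=
  ∑ m ∈ Finset.Icc 1 N, Real.log m ^ k / m - Real.log N ^ (k + 1) / (k + 1)

/-- The Stieltjes constant `γ_k`; the limit exists by `tendsto_stieltjesSeq`. -/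
noncomputable def stieltjesConstant (k : ℕ) : ℝ := limUnder atTop (stieltjesSeq k)

theorem antitoneOn_log_pow_div (k : ℕ) :
    AntitoneOn (fun x : ℝ => Real.log x ^ k / x) (Set.Ici (Real.exp k)) := by
  intro x hx y hy hxy
  simp only [Set.mem_Ici] at hx hy
  have hx0 : 0 < x := (Real.exp_pos _).trans_le hx
  have hy0 : 0 < y := (Real.exp_pos _).trans_le hy
  rcases Nat.eq_zero_or_pos k with rfl | hk
  · simpa using inv_anti₀ hx0 hxy
  have hk0 : (0 : ℝ) < k := by exact_mod_cast hk
  have key : ∀ z : ℝ, 0 < z → Real.log z ^ k / z = (Real.log z / z ^ (1 / (k : ℝ))) ^ k := by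
    intro z hz
    rw [div_pow, ← Real.rpow_natCast (z ^ (1 / (k : ℝ))) k, ← Real.rpow_mul hz.le,
      one_div_mul_cancel hk0.ne', Real.rpow_one]
  have h := Real.log_div_self_rpow_antitoneOn (a := 1 / (k : ℝ)) (by positivity)
    (by simpa using hx) (by simpa using hy) hxy
  simp only at h ⊢
  rw [key x hx0, key y hy0]
  refine pow_le_pow_left₀ ?_ h k
  have : 0 ≤ Real.log y := Real.log_nonneg ((Real.one_le_exp hk0.le).trans hy)
  positivity

theorem tendsto_stieltjesSeq (k : ℕ) :
    Tendsto (stieltjesSeq k) atTop (𝓝 (stieltjesConstant k)) := by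
  apply tendsto_nhds_limUnder
  set M : ℕ := ⌈Real.exp k⌉₊ with hM
  have hM' : Real.exp k ≤ M := Nat.le_ceil _
  have hMpos : (0 : ℝ) < M := (Real.exp_pos _).trans_le hM'
  have hstep : ∀ N : ℕ, M ≤ N →
      Real.log (N + 1 : ℕ) ^ k / (N + 1 : ℕ) ≤
        Real.log (N + 1 : ℕ) ^ (k + 1) / (k + 1) - Real.log N ^ (k + 1) / (k + 1) ∧
      Real.log (N + 1 : ℕ) ^ (k + 1) / (k + 1) - Real.log N ^ (k + 1) / (k + 1) ≤
        Real.log N ^ k / N := by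
    intro N hN
    have hN' : (M : ℝ) ≤ N := by exact_mod_cast hN
    have hd : ∀ x : ℝ, 0 < x →
        HasDerivAt (fun x : ℝ => Real.log x ^ (k + 1) / (k + 1)) (Real.log x ^ k / x) x := by
      intro x hx
      have h0 : (k : ℝ) + 1 ≠ 0 := by positivity
      refine (((Real.hasDerivAt_log hx.ne').fun_pow (k + 1)).div_const ((k : ℝ) + 1)).congr_deriv ?_
      rw [Nat.add_sub_cancel]
      push_cast
      field_simp
    have hNpos : (0 : ℝ) < N := hMpos.trans_le hN'
    obtain ⟨c, ⟨hc1, hc2⟩, hc⟩ := exists_hasDerivAt_eq_slope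
      (fun x : ℝ => Real.log x ^ (k + 1) / (k + 1)) (fun x => Real.log x ^ k / x)
      (a := (N : ℝ)) (b := ((N + 1 : ℕ) : ℝ)) (by push_cast; linarith)
      (fun x hx => (hd x (hNpos.trans_le hx.1)).continuousAt.continuousWithinAt)
      (fun x hx => hd x (hNpos.trans hx.1))
    have hone : ((N + 1 : ℕ) : ℝ) - N = 1 := by push_cast; ring
    rw [hone, div_one] at hc
    rw [← hc]
    have hN1 : Real.exp k ≤ N := hM'.trans hN'
    exact ⟨antitoneOn_log_pow_div k (hN1.trans hc1.le) (hN1.trans (hc1.trans hc2).le) hc2.le,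
      antitoneOn_log_pow_div k hN1 (hN1.trans hc1.le) hc1.le⟩
  have hsucc : ∀ N : ℕ, stieltjesSeq k (N + 1) = stieltjesSeq k N +
      Real.log (N + 1 : ℕ) ^ k / (N + 1 : ℕ) -
      (Real.log (N + 1 : ℕ) ^ (k + 1) / (k + 1) - Real.log N ^ (k + 1) / (k + 1)) := by
    intro N
    rw [stieltjesSeq, stieltjesSeq, Finset.sum_Icc_succ_top (by omega)]
    ring
  have hanti : Antitone fun j => stieltjesSeq k (j + M) := by
    refine antitone_nat_of_succ_le fun j => ?_
    have h1 := (hstep (j + M) (by omega)).1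
    have h2 := hsucc (j + M)
    rw [show j + 1 + M = j + M + 1 by ring]
    linarith
  have hlow : ∀ j, stieltjesSeq k M - Real.log M ^ k / M ≤
      stieltjesSeq k (j + M) - Real.log (j + M : ℕ) ^ k / (j + M : ℕ) := by
    intro j
    induction j with
    | zero => simp
    | succ j ih =>
      have h1 := (hstep (j + M) (by omega)).2
      have h2 := hsucc (j + M)
      rw [show j + 1 + M = j + M + 1 by ring]
      linarith
  have hbdd : BddBelow (Set.range fun j => stieltjesSeq k (j + M)) := by
    refine ⟨stieltjesSeq k M - Real.log M ^ k / M, ?_⟩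
    rintro _ ⟨j, rfl⟩
    have : 0 ≤ Real.log (j + M : ℕ) ^ k / (j + M : ℕ) := by positivity
    linarith [hlow j]
  exact ⟨_, (tendsto_add_atTop_iff_nat M).1 (tendsto_atTop_ciInf hanti hbdd)⟩

/-- The numbers `ℓ_0 = γ_0 - 1` and
`ℓ_n = (-1)^n ∑_{k=1}^n C(n-1, k-1) (-1)^k γ_k / k!` for `n ≥ 1`. -/
noncomputable def ell (n : ℕ) : ℝ :=
  if n = 0 then stieltjesConstant 0 - 1
  else (-1) ^ n * ∑ k ∈ Finset.Icc 1 n,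
    ((n - 1).choose (k - 1) : ℝ) * ((-1) ^ k * stieltjesConstant k / (k.factorial : ℝ))

/-- The Boole transformation `Tx = (x - 1 / (4x)) / 2` for `x ≠ 0`, and `T0 = 0`. -/
noncomputable def boole (x : ℝ) : ℝ :=
  if x = 0 then 0 else 1 / 2 * (x - 1 / (4 * x))

end ZetaBoole

/-! The map y ↦ -cot(πy)/2 from the circle ℝ/ℤ intertwines the doubling map with T and carries Haar
measure to μ. Doubling is ergodic, so Birkhoff's theorem transfers to T
(`ae_tendsto_average_boole`). Once ζ(1/2 + it) is known to lie in L²(μ), its product with g is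
integrable and the averages converge almost everywhere to ∫ ζ(1/2 + it) g(t) dμ(t). By Parseval
(`hasSum_fourierCoefficient_mul`) this integral is the sum over m ∈ ℤ of z_m a_{-m}, where z_m are
the Fourier coefficients of ζ(1/2 + it).

To find z_m, put s = 1/2 + it and Z_N(s) = ∑_{m ≤ N} m^{-s} - ∫_1^N x^{-s} dx. Then ζ(s) - 1/(s-1) =
Z_N(s) - s ∫_N^∞ {x} x^{-s-1} dx (`riemannZeta_sub_eq`). Since dμ = dt / (2π|s|²), Plancherel for
the Mellin transform bounds the L²(μ) norm of the last term by N^{-1/2} (`memLp_mul_fractIntegral`).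
Hence ζ is square integrable on the line and the coefficients of Z_N converge to those of ζ(s) -
1/(s-1).

The coefficients of Z_N are explicit. Write x^{-s} = x^{-1} exp((1-s)u) with u = log x ≥ 0. The n-th
coefficient of exp((1-s)u) is 0 for n < 0, 1 for n = 0, and a Laguerre-type polynomial in u for n ≥
1 (`expCoeff_neg`, `expCoeff_zero`, `expCoeff_pos`). Each power of log x produces a Stieltjes
sequence, so the limits are γ_0 and ℓ_n. Finally 1/(s-1) = -(e_{-1} + e_0): the pole accounts for
the term -a_1 and for the -1 in ℓ_0. -/

namespace ZetaBoole

/-! ### Birkhoff's ergodic theorem for ergodic maps, through maximal functions -/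

section Birkhoff

variable {α : Type*} {T : α → α} {f : α → ℝ}

/-- The maximal function `max_{1 ≤ k ≤ n + 1} S_k f` of the Birkhoff sums of `f`. -/
def maxBirkhoff (T : α → α) (f : α → ℝ) : ℕ → α → ℝ
  | 0 => f
  | n + 1 => fun x => f x + max 0 (maxBirkhoff T f n (T x))

theorem maxBirkhoff_le_succ (n : ℕ) (x : α) : maxBirkhoff T f n x ≤ maxBirkhoff T f (n + 1) x := by
  induction n generalizing x with
  | zero => simp [maxBirkhoff]
  | succ n ih =>
    have := ih (T x)
    simp only [maxBirkhoff] at this ⊢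
    gcongr

theorem birkhoffSum_le_maxBirkhoff (n : ℕ) (x : α) :
    birkhoffSum T f (n + 1) x ≤ maxBirkhoff T f n x := by
  induction n generalizing x with
  | zero => simp [maxBirkhoff]
  | succ n ih =>
    rw [birkhoffSum_succ' T f (n + 1) x]
    simp only [maxBirkhoff]
    gcongr
    exact (ih (T x)).trans (le_max_right _ _)

variable [MeasurableSpace α] {μ : Measure α}

theorem integrable_maxBirkhoff (hT : MeasurePreserving T μ μ) (hf : Integrable f μ) (n : ℕ) :
    Integrable (maxBirkhoff T f n) μ := by
  induction n with
  | zero => exact hf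
  | succ n ih =>
    have h := (hT.integrable_comp_of_integrable ih).pos_part
    refine hf.add (h.congr (ae_of_all _ fun x => ?_))
    simp [max_comm]

/-- If `∫ f < 0` then almost every orbit has Birkhoff sums bounded above. -/
theorem ae_exists_maxBirkhoff_le (hT : Ergodic T μ) (hf : Integrable f μ) (hneg : ∫ x, f x ∂μ < 0) :
    ∀ᵐ x ∂μ, ∃ k : ℕ, ∀ n, maxBirkhoff T f n x ≤ k := by
  set M := maxBirkhoff T f with hM
  have hMi := fun n => integrable_maxBirkhoff hT.toMeasurePreserving hf n
  have hmono : ∀ x, Monotone fun n => M n x := fun x =>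
    monotone_nat_of_le_succ fun n => maxBirkhoff_le_succ n x
  -- The set where the Birkhoff sums are unbounded above. It is strictly invariant because `M (n +
  -- 1) x` and the positive part of `M n (T x)` differ by `f x`; ergodicity makes it null or conull.
  set A : Set α := {x | ∀ k : ℕ, ∃ n, (k : ℝ) < M n x} with hA
  have hAm : NullMeasurableSet A μ := by
    have : A = ⋂ k : ℕ, ⋃ n, {x | (k : ℝ) < M n x} := by ext x; simp [hA]
    rw [this]
    exact .iInter fun k => .iUnion fun n =>
      nullMeasurableSet_lt aemeasurable_const (hMi n).aestronglyMeasurable.aemeasurable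
  have hinv : T ⁻¹' A = A := by
    ext x
    simp only [hA, Set.mem_preimage, Set.mem_ofPred_eq]
    constructor
    · intro h k
      obtain ⟨j, hj⟩ := exists_nat_ge (k - f x)
      obtain ⟨n, hn⟩ := h j
      refine ⟨n + 1, ?_⟩
      have : M (n + 1) x = f x + max 0 (M n (T x)) := rfl
      have h2 := le_max_right 0 (M n (T x))
      linarith
    · intro h k
      obtain ⟨j, hj⟩ := exists_nat_ge (k + |f x|)
      obtain ⟨n, hn⟩ := h j
      have h1 := hn.trans_le (hmono x n.le_succ)
      have h3 : M (n + 1) x = f x + max 0 (M n (T x)) := rfl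
      refine ⟨n, ?_⟩
      have hk : (0 : ℝ) ≤ k := k.cast_nonneg
      have h4 : (k : ℝ) < max 0 (M n (T x)) := by
        have := le_abs_self (f x)
        linarith
      rcases lt_max_iff.1 h4 with h | h
      · linarith
      · exact h
  rcases hT.quasiErgodic.ae_empty_or_univ₀ hAm (by rw [hinv]; exact EventuallyEq.rfl) with h | h
  · have : ∀ᵐ x ∂μ, x ∉ A := measure_eq_zero_iff_ae_notMem.1 (ae_eq_empty.1 h)
    filter_upwards [this] with x hx
    simpa [hA] using hx
  · exfalso
    have hxA : ∀ᵐ x ∂μ, x ∈ A := eventuallyEq_univ.1 h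
    have hTi := fun n => hT.toMeasurePreserving.integrable_comp_of_integrable (hMi n)
    -- The integrand is `f x` plus the negative part of `M n (T x)`. On `A` the latter is eventually
    -- 0, and it decreases in `n`, so its value at `n = 0` dominates. Invariance of μ and
    -- monotonicity of `M` make every integral nonnegative, contradicting ∫ f < 0.
    have hlim : Tendsto (fun n => ∫ x, (M (n + 1) x - M n (T x)) ∂μ) atTop (𝓝 (∫ x, f x ∂μ)) := by
      refine tendsto_integral_of_dominated_convergence (fun x => |f x| + |M 0 (T x)|)
        (fun n => ((hMi (n + 1)).sub (hTi n)).aestronglyMeasurable)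
        (hf.abs.add (hTi 0).abs) (fun n => ae_of_all _ fun x => ?_) ?_
      · have h3 : M (n + 1) x = f x + max 0 (M n (T x)) := rfl
        have h4 := hmono (T x) (Nat.zero_le n)
        simp only at h4
        rw [Real.norm_eq_abs, h3]
        have h5 : |max 0 (M n (T x)) - M n (T x)| ≤ |M 0 (T x)| := by
          rcases le_total 0 (M n (T x)) with h | h
          · simp [h]
          · rw [max_eq_left h, zero_sub, abs_neg, abs_of_nonpos h, abs_of_nonpos (h4.trans h)]
            linarith
        calc _ = |f x + (max 0 (M n (T x)) - M n (T x))| := by ring_nf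
          _ ≤ _ := (abs_add_le _ _).trans (by gcongr)
      · filter_upwards [hxA] with x hx
        have hx' : T x ∈ A := by rw [← Set.mem_preimage, hinv]; exact hx
        obtain ⟨n₀, hn₀⟩ := hx' 0
        refine tendsto_const_nhds.congr' ?_
        filter_upwards [eventually_ge_atTop n₀] with n hn
        have h3 : M (n + 1) x = f x + max 0 (M n (T x)) := rfl
        have h4 : M n₀ (T x) ≤ M n (T x) := hmono (T x) hn
        simp only [Nat.cast_zero] at hn₀
        rw [h3, max_eq_right (hn₀.le.trans h4)]
        ring
    refine hneg.not_ge (ge_of_tendsto' hlim fun n => ?_)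
    have h0 : ∫ x, (M (n + 1) x - M n (T x)) ∂μ = ∫ x, M (n + 1) x ∂μ - ∫ x, M n (T x) ∂μ :=
      integral_sub (hMi (n + 1)) (hTi n)
    rw [h0]
    have h1 : ∫ x, M n (T x) ∂μ = ∫ x, M n x ∂μ := by
      have := hT.toMeasurePreserving.map_eq
      conv_rhs => rw [← this]
      rw [integral_map hT.measurable.aemeasurable]
      rw [this]; exact (hMi n).aestronglyMeasurable
    rw [h1, sub_nonneg]
    exact integral_mono (hMi n) (hMi (n + 1)) fun x => maxBirkhoff_le_succ n x

variable [IsProbabilityMeasure μ]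

/-- Subtracting ∫ f + ε/2 makes the integral negative, so the shifted sums are bounded above by some
`k`; the remaining nε/2 absorbs `k` for large n. -/
theorem ae_eventually_birkhoffSum_le (hT : Ergodic T μ) (hf : Integrable f μ) {ε : ℝ} (hε : 0 < ε) :
    ∀ᵐ x ∂μ, ∀ᶠ n : ℕ in atTop, birkhoffSum T f n x ≤ n * (∫ x, f x ∂μ + ε) := by
  set c := ∫ x, f x ∂μ + ε / 2 with hc
  have hg : Integrable (fun x => f x - c) μ := hf.sub (integrable_const c)
  have hneg : ∫ x, (f x - c) ∂μ < 0 := by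
    rw [integral_sub hf (integrable_const c)]
    simp [hc, hε]
  filter_upwards [ae_exists_maxBirkhoff_le hT hg hneg] with x ⟨k, hk⟩
  obtain ⟨N, hN⟩ := exists_nat_ge (k / (ε / 2))
  filter_upwards [eventually_ge_atTop (N + 1)] with n hn
  obtain ⟨m, rfl⟩ : ∃ m, n = m + 1 := ⟨n - 1, by omega⟩
  have h1 := (birkhoffSum_le_maxBirkhoff (T := T) (f := fun x => f x - c) m x).trans (hk m)
  have h2 : birkhoffSum T (fun x => f x - c) (m + 1) x
      = birkhoffSum T f (m + 1) x - (m + 1 : ℕ) * c := by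
    simp [birkhoffSum, Finset.sum_sub_distrib]
  rw [h2] at h1
  have h3 : (k : ℝ) ≤ N * (ε / 2) := by rwa [div_le_iff₀ (by positivity)] at hN
  have h4 : (N : ℝ) ≤ (m + 1 : ℕ) := by exact_mod_cast (Nat.le_succ N).trans hn
  have h5 : (N : ℝ) * (ε / 2) ≤ (m + 1 : ℕ) * (ε / 2) := by gcongr
  have h6 : ((m + 1 : ℕ) : ℝ) * (∫ x, f x ∂μ + ε) = (m + 1 : ℕ) * c + (m + 1 : ℕ) * (ε / 2) := by
    rw [hc]; ring
  linarith

/-- **Birkhoff's pointwise ergodic theorem** for an ergodic map and a real function. -/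
theorem ae_tendsto_birkhoffAverage (hT : Ergodic T μ) (hf : Integrable f μ) :
    ∀ᵐ x ∂μ, Tendsto (fun n => birkhoffAverage ℝ T f n x) atTop (𝓝 (∫ x, f x ∂μ)) := by
  have h1 : ∀ᵐ x ∂μ, ∀ j : ℕ, ∀ᶠ n : ℕ in atTop,
      birkhoffSum T f n x ≤ n * (∫ x, f x ∂μ + 1 / (j + 1)) :=
    ae_all_iff.2 fun j => ae_eventually_birkhoffSum_le hT hf (by positivity)
  have h2 : ∀ᵐ x ∂μ, ∀ j : ℕ, ∀ᶠ n : ℕ in atTop,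
      birkhoffSum T (-f) n x ≤ n * (∫ x, (-f) x ∂μ + 1 / (j + 1)) :=
    ae_all_iff.2 fun j => ae_eventually_birkhoffSum_le hT hf.neg (by positivity)
  filter_upwards [h1, h2] with x hx1 hx2
  rw [Metric.tendsto_atTop]
  intro ε hε
  obtain ⟨j, hj⟩ := exists_nat_one_div_lt hε
  obtain ⟨N, hN⟩ := eventually_atTop.1
    ((hx1 j).and ((hx2 j).and (eventually_gt_atTop 0)))
  refine ⟨N, fun n hn => ?_⟩
  obtain ⟨ha, hb, hn0⟩ := hN n hn
  have hn0' : (0 : ℝ) < n := by exact_mod_cast hn0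
  rw [birkhoffSum_neg] at hb
  simp only [Pi.neg_apply, integral_neg] at hb
  rw [Real.dist_eq, birkhoffAverage, smul_eq_mul, inv_mul_eq_div, abs_lt]
  constructor
  · rw [lt_sub_iff_add_lt, lt_div_iff₀ hn0']
    nlinarith
  · rw [sub_lt_iff_lt_add, div_lt_iff₀ hn0']
    nlinarith

/-- **Birkhoff's pointwise ergodic theorem** for an ergodic map and a complex function. -/
theorem ae_tendsto_average_complex (hT : Ergodic T μ) {F : α → ℂ} (hF : Integrable F μ) :
    ∀ᵐ x ∂μ, Tendsto (fun N : ℕ => (1 / (N : ℂ)) * ∑ n ∈ Finset.range N, F (T^[n] x)) atTop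
      (𝓝 (∫ x, F x ∂μ)) := by
  filter_upwards [ae_tendsto_birkhoffAverage hT hF.re, ae_tendsto_birkhoffAverage hT hF.im]
    with x hx1 hx2
  have h := ((Complex.continuous_ofReal.tendsto _).comp hx1).add
    (((Complex.continuous_ofReal.tendsto _).comp hx2).mul_const Complex.I)
  have hint := integral_re_add_im hF
  simp only [RCLike.re_to_complex, RCLike.im_to_complex, RCLike.I_to_complex,
    Complex.coe_algebraMap] at hint h
  rw [← hint]
  refine h.congr fun N => ?_
  simp only [Function.comp_apply, birkhoffAverage, birkhoffSum, smul_eq_mul]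
  push_cast
  rw [one_div, mul_assoc, ← mul_add, Finset.sum_mul, ← Finset.sum_add_distrib]
  congr 1
  exact Finset.sum_congr rfl fun n _ => Complex.re_add_im _

end Birkhoff

/-! ### The Cauchy measure and the circle -/

theorem mu_eq_withDensity :
    mu = volume.withDensity
      fun t => ENNReal.ofReal (1 / (2 * Real.pi) * (1 / (1 / 4 + t ^ 2))) := by
  ext A hA
  rw [mu_apply A hA, withDensity_apply _ hA]

instance : IsProbabilityMeasure mu := by unfold mu; infer_instance

theorem volume_absolutelyContinuous_mu : volume ≪ mu := by
  rw [mu_eq_withDensity]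
  refine withDensity_absolutelyContinuous' (by fun_prop) (ae_of_all _ fun t => ?_)
  simp only [ne_eq, ENNReal.ofReal_eq_zero, not_le]
  positivity

theorem mu_absolutelyContinuous_volume : mu ≪ volume := by
  rw [mu_eq_withDensity]
  exact withDensity_absolutelyContinuous _ _

/-- The angle in `(0, 1)` of a point of the line. -/
noncomputable def angle (x : ℝ) : ℝ := Real.arctan (2 * x) / Real.pi + 1 / 2

theorem hasDerivAt_angle (x : ℝ) :
    HasDerivAt angle (1 / (2 * Real.pi) * (1 / (1 / 4 + x ^ 2))) x := by
  unfold angle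
  have h := (((hasDerivAt_id x).const_mul 2).arctan.div_const Real.pi).add_const (1 / 2 : ℝ)
  refine h.congr_deriv ?_
  have h1 : 1 / 4 + x ^ 2 ≠ 0 := by positivity
  have h2 : 1 + (2 * x) ^ 2 ≠ 0 := by positivity
  simp only [id]
  field_simp
  ring

theorem continuous_angle : Continuous angle := by
  unfold angle; fun_prop

theorem angle_injective : Function.Injective angle := by
  intro x y h
  have h1 : Real.arctan (2 * x) = Real.arctan (2 * y) := by
    have := Real.pi_ne_zero
    unfold angle at h
    field_simp at h
    linarith
  have := Real.arctan_injective h1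
  linarith

theorem range_angle : Set.range angle = Set.Ioo 0 1 := by
  have hpi := Real.pi_pos
  ext y
  constructor
  · rintro ⟨x, rfl⟩
    have h1 := Real.neg_pi_div_two_lt_arctan (2 * x)
    have h2 := Real.arctan_lt_pi_div_two (2 * x)
    unfold angle
    constructor
    · have : -(1 / 2) < Real.arctan (2 * x) / Real.pi := by
        rw [lt_div_iff₀ hpi]; linarith
      linarith
    · have : Real.arctan (2 * x) / Real.pi < 1 / 2 := by
        rw [div_lt_iff₀ hpi]; linarith
      linarith
  · rintro ⟨h0, h1⟩
    refine ⟨Real.tan (Real.pi * (y - 1 / 2)) / 2, ?_⟩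
    unfold angle
    rw [mul_div_cancel₀ _ two_ne_zero, Real.arctan_tan (by nlinarith) (by nlinarith)]
    field_simp
    ring

/-- `angle` is the distribution function of μ: its derivative is the density, so it pushes μ to the
uniform law. The half-open interval is the fundamental domain used for the circle. -/
theorem measurePreserving_angle :
    MeasurePreserving angle mu (volume.restrict (Set.Ioc 0 1)) := by
  refine ⟨continuous_angle.measurable, ?_⟩
  ext A hA
  have hA' : MeasurableSet (angle ⁻¹' A) := continuous_angle.measurable hA
  rw [Measure.map_apply continuous_angle.measurable hA, mu_apply _ hA', Measure.restrict_apply hA]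
  have h := lintegral_image_eq_lintegral_abs_deriv_mul hA'
    (fun x _ => (hasDerivAt_angle x).hasDerivWithinAt) angle_injective.injOn 1
  rw [Set.image_preimage_eq_inter_range, range_angle] at h
  simp only [Pi.one_apply, mul_one, lintegral_const, Measure.restrict_apply MeasurableSet.univ,
    Set.univ_inter, one_mul] at h
  have h2 : volume (A ∩ Set.Ioc (0 : ℝ) 1) = volume (A ∩ Set.Ioo (0 : ℝ) 1) :=
    measure_congr ((ae_eq_refl A).inter Ioo_ae_eq_Ioc.symm)
  rw [h2, h]
  refine lintegral_congr fun x => ?_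
  rw [abs_of_nonneg (by positivity)]

/-- The map from the line to the circle that conjugates the Boole transformation to doubling. -/
noncomputable def toCircleMap (x : ℝ) : AddCircle (1 : ℝ) := (angle x : AddCircle (1 : ℝ))

theorem volume_eq_haarAddCircle :
    (volume : Measure (AddCircle (1 : ℝ))) = AddCircle.haarAddCircle := by
  rw [AddCircle.volume_eq_smul_haarAddCircle]; simp

theorem measurePreserving_toCircleMap :
    MeasurePreserving toCircleMap mu (AddCircle.haarAddCircle (T := (1 : ℝ))) := by
  have h := AddCircle.measurePreserving_mk (1 : ℝ) 0
  rw [zero_add, volume_eq_haarAddCircle] at h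
  exact h.comp measurePreserving_angle

/-- The inverse of `toCircleMap`, equal to `-cot(πy) / 2`. -/
noncomputable def ofCircleMap (y : AddCircle (1 : ℝ)) : ℝ :=
  -(1 / 2) * ((fourier 1 y : ℂ).im / (1 - (fourier 1 y : ℂ).re))

theorem measurable_ofCircleMap : Measurable ofCircleMap := by
  have h : Continuous fun y : AddCircle (1 : ℝ) => (fourier 1 y : ℂ) :=
    (fourier (T := (1 : ℝ)) 1).continuous
  exact ((Complex.continuous_im.comp h).measurable.div
    (measurable_const.sub (Complex.continuous_re.comp h).measurable)).const_mul _

theorem fourier_toCircleMap_one (x : ℝ) :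
    (fourier 1 (toCircleMap x) : ℂ) = -((1 / 2 + Complex.I * x) / (1 / 2 - Complex.I * x)) := by
  have hpi : (Real.pi : ℂ) ≠ 0 := by exact_mod_cast Real.pi_ne_zero
  set θ := Real.arctan (2 * x) with hθ
  have hexp : Complex.exp (2 * Real.pi * Complex.I * (1 : ℤ) * (angle x : ℝ) / (1 : ℝ))
      = -(Complex.exp (θ * Complex.I) * Complex.exp (θ * Complex.I)) := by
    rw [← Complex.exp_add, ← mul_neg_one, ← Complex.exp_pi_mul_I, ← Complex.exp_add]
    congr 1
    unfold angle
    rw [← hθ]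
    push_cast
    field_simp
    ring
  rw [toCircleMap, fourier_coe_apply, hexp, Complex.exp_mul_I, ← Complex.ofReal_cos,
    ← Complex.ofReal_sin]
  have hx : (1 / 2 - Complex.I * x) ≠ 0 := by
    intro h; have := congrArg Complex.re h; simp at this
  have hc : Real.cos θ ≠ 0 := (Real.cos_arctan_pos _).ne'
  have hs : Real.sin θ = 2 * x * Real.cos θ := by
    rw [hθ, ← Real.tan_mul_cos (x := Real.arctan (2 * x)) hc, Real.tan_arctan]
  have hc2 : Real.cos θ ^ 2 * (1 + (2 * x) ^ 2) = 1 := by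
    rw [hθ, Real.cos_sq_arctan]
    field_simp
  have hc2' : (Real.cos θ : ℂ) ^ 2 * (1 + (2 * x) ^ 2) = 1 := by exact_mod_cast hc2
  rw [hs]
  push_cast at hc2' ⊢
  congr 1
  rw [eq_div_iff hx]
  have hI := Complex.I_sq
  linear_combination (1 / 2 + Complex.I * x) * hc2' +
    (-2 * x ^ 2 * Complex.cos θ ^ 2 - 4 * Complex.I * x ^ 3 * Complex.cos θ ^ 2) * hI

theorem fourier_toCircleMap (n : ℤ) (x : ℝ) :
    (fourier n (toCircleMap x) : ℂ) = (-1) ^ n * e (-n) x := by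
  have h1 : (fourier n (toCircleMap x) : ℂ) = (fourier 1 (toCircleMap x) : ℂ) ^ n := by
    rw [fourier_apply, fourier_apply, one_zsmul, AddCircle.toCircle_zsmul, Circle.coe_zpow]
  rw [h1, fourier_toCircleMap_one, e, neg_eq_neg_one_mul, mul_zpow, zpow_neg, ← inv_zpow, inv_div]

theorem ofCircleMap_toCircleMap (x : ℝ) : ofCircleMap (toCircleMap x) = x := by
  have h : -((1 / 2 + Complex.I * x) / (1 / 2 - Complex.I * x))
      = (((x ^ 2 - 1 / 4) / (x ^ 2 + 1 / 4) : ℝ) : ℂ) +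
        ((-x / (x ^ 2 + 1 / 4) : ℝ) : ℂ) * Complex.I := by
    have hx : (1 / 2 - Complex.I * x) ≠ 0 := by
      intro h; have := congrArg Complex.re h; simp at this
    have h0 : (x ^ 2 + 1 / 4 : ℝ) ≠ 0 := by positivity
    have h0' : ((x : ℂ) ^ 2 + 1 / 4) ≠ 0 := by
      rw [show ((x : ℂ) ^ 2 + 1 / 4) = ((x ^ 2 + 1 / 4 : ℝ) : ℂ) by push_cast; ring]
      exact Complex.ofReal_ne_zero.2 h0
    push_cast
    rw [show ((x : ℂ) ^ 2 - 1 / 4) / (x ^ 2 + 1 / 4) + -x / (x ^ 2 + 1 / 4) * Complex.I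
      = (x ^ 2 - 1 / 4 - x * Complex.I) / (x ^ 2 + 1 / 4) by ring, ← neg_div, div_eq_div_iff hx h0']
    linear_combination (-(x : ℂ) ^ 2) * Complex.I_sq
  rw [ofCircleMap, fourier_toCircleMap_one, h, Complex.add_re, Complex.add_im,
    Complex.re_ofReal_mul, Complex.im_ofReal_mul]
  simp only [Complex.ofReal_re, Complex.ofReal_im, Complex.I_re, Complex.I_im]
  have h0 : (x ^ 2 + 1 / 4 : ℝ) ≠ 0 := by positivity
  have h1 : 1 - ((x ^ 2 - 1 / 4) / (x ^ 2 + 1 / 4) + -x / (x ^ 2 + 1 / 4) * 0)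
      = (1 / 2) / (x ^ 2 + 1 / 4) := by field_simp; ring
  rw [h1]
  field_simp
  ring

/-- This is the duplication formula cot 2θ = (cot θ - tan θ)/2. -/
theorem boole_ofCircleMap (y : AddCircle (1 : ℝ)) :
    boole (ofCircleMap y) = ofCircleMap (2 • y) := by
  have h2 : (fourier 1 (2 • y) : ℂ) = fourier 1 y * fourier 1 y := by
    rw [fourier_one, fourier_one, two_nsmul, AddCircle.toCircle_add, Circle.coe_mul]
  have hn : (fourier 1 y : ℂ).re ^ 2 + (fourier 1 y : ℂ).im ^ 2 = 1 := by
    have : Complex.normSq (fourier 1 y : ℂ) = 1 := by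
      rw [fourier_one, Circle.normSq_coe]
    rw [Complex.normSq_apply] at this
    linarith
  rw [ofCircleMap, ofCircleMap, h2, Complex.mul_re, Complex.mul_im]
  generalize (fourier 1 y : ℂ).re = a at hn
  generalize (fourier 1 y : ℂ).im = b at hn
  -- Here y is 0 or 1/2. Both sides vanish, thanks to `boole 0 = 0` and division by zero being 0, so
  -- the semiconjugacy has no exceptional points.
  by_cases hb : b = 0
  · simp [hb, boole]
  · have ha : 1 - a ≠ 0 := by
      intro h
      have : a = 1 := by linarith
      rw [this] at hn
      exact hb (by nlinarith)
    have h3 : -(1 / 2) * (b / (1 - a)) ≠ 0 := by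
      have : b / (1 - a) ≠ 0 := div_ne_zero hb ha
      simpa using this
    rw [boole, if_neg h3]
    have h4 : 1 - (a * a - b * b) = 2 * b ^ 2 := by linarith
    rw [h4]
    field_simp
    linear_combination (-4 : ℝ) * hn

theorem boole_iterate_ofCircleMap (n : ℕ) (y : AddCircle (1 : ℝ)) :
    boole^[n] (ofCircleMap y) = ofCircleMap ((fun z => 2 • z)^[n] y) := by
  have h : Function.Semiconj ofCircleMap (fun z => 2 • z) boole := fun y =>
    (boole_ofCircleMap y).symm
  exact ((h.iterate_right n).eq y).symm

theorem measurePreserving_ofCircleMap :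
    MeasurePreserving ofCircleMap (AddCircle.haarAddCircle (T := (1 : ℝ))) mu := by
  refine ⟨measurable_ofCircleMap, ?_⟩
  rw [← measurePreserving_toCircleMap.map_eq,
    Measure.map_map measurable_ofCircleMap measurePreserving_toCircleMap.measurable]
  have : ofCircleMap ∘ toCircleMap = id := funext ofCircleMap_toCircleMap
  rw [this, Measure.map_id]

/-- The pointwise ergodic theorem for the Boole transformation. -/
theorem ae_tendsto_average_boole {F : ℝ → ℂ} (hF : Integrable F mu) :
    ∀ᵐ x : ℝ, Tendsto
      (fun N : ℕ => (1 / (N : ℂ)) * ∑ n ∈ Finset.range N, F (boole^[n] x)) atTop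
      (𝓝 (∫ x, F x ∂mu)) := by
  refine volume_absolutelyContinuous_mu.ae_le ?_
  have herg : Ergodic (fun y : AddCircle (1 : ℝ) => 2 • y) AddCircle.haarAddCircle := by
    rw [← volume_eq_haarAddCircle]
    exact AddCircle.ergodic_nsmul one_lt_two
  have h := ae_tendsto_average_complex herg
    (measurePreserving_ofCircleMap.integrable_comp_of_integrable hF)
  have hint : ∫ y, (F ∘ ofCircleMap) y ∂(AddCircle.haarAddCircle (T := (1 : ℝ))) = ∫ x, F x ∂mu := by
    rw [← measurePreserving_ofCircleMap.map_eq, integral_map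
      measurable_ofCircleMap.aemeasurable]
    · rfl
    · rw [measurePreserving_ofCircleMap.map_eq]; exact hF.aestronglyMeasurable
  rw [hint] at h
  -- As `ofCircleMap` is a left inverse of `toCircleMap`, the orbit of x is the image of the
  -- doubling orbit of `toCircleMap x`.
  filter_upwards [measurePreserving_toCircleMap.quasiMeasurePreserving.ae h] with x hx
  refine hx.congr fun N => ?_
  congr 1
  refine Finset.sum_congr rfl fun n _ => ?_
  rw [Function.comp_apply, ← boole_iterate_ofCircleMap, ofCircleMap_toCircleMap]

/-! ### The basis `e` -/

theorem conj_e (m : ℤ) (t : ℝ) : (starRingEnd ℂ) (e m t) = e (-m) t := by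
  rw [e, e, map_zpow₀, zpow_neg, ← inv_zpow, inv_div]
  congr 1
  have h : (starRingEnd ℂ) (1 / 2 : ℂ) = 1 / 2 := by
    rw [map_div₀, map_one, Complex.conj_ofNat]
  rw [map_div₀, map_sub, map_add, map_mul, h, Complex.conj_I, Complex.conj_ofReal]
  ring_nf

theorem norm_e (m : ℤ) (t : ℝ) : ‖e m t‖ = 1 := by
  have h := fourier_toCircleMap (-m) t
  rw [neg_neg] at h
  have h1 : ‖(fourier (-m) (toCircleMap t) : ℂ)‖ = 1 := Circle.norm_coe _
  rw [h, norm_mul, norm_zpow, norm_neg, norm_one, one_zpow, one_mul] at h1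
  exact h1

theorem half_add_ne_zero (t : ℝ) : (1 / 2 + Complex.I * t : ℂ) ≠ 0 := by
  intro h; have := congrArg Complex.re h; simp at this

theorem half_sub_ne_zero (t : ℝ) : (1 / 2 - Complex.I * t : ℂ) ≠ 0 := by
  intro h; have := congrArg Complex.re h; simp at this

theorem e_zero (t : ℝ) : e 0 t = 1 := by simp [e]

theorem e_add (m n : ℤ) (t : ℝ) : e (m + n) t = e m t * e n t := by
  rw [e, e, e, zpow_add₀ (div_ne_zero (half_sub_ne_zero t) (half_add_ne_zero t))]

theorem continuous_e (m : ℤ) : Continuous (e m) := by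
  have h : Continuous fun t : ℝ => (1 / 2 - Complex.I * t : ℂ) / (1 / 2 + Complex.I * t) :=
    Continuous.div (by fun_prop) (by fun_prop) half_add_ne_zero
  exact h.zpow₀ m fun t => Or.inl (div_ne_zero (half_sub_ne_zero t) (half_add_ne_zero t))

theorem memLp_e (m : ℤ) : MemLp (e m) 2 mu :=
  MemLp.of_bound (continuous_e m).aestronglyMeasurable 1
    (ae_of_all _ fun t => (norm_e m t).le)

theorem integral_mul_e_neg_eq {f : ℝ → ℂ} (hf : AEStronglyMeasurable f mu) (i : ℤ) :
    ∫ y, (fourier i y : ℂ) * f (ofCircleMap y) ∂(AddCircle.haarAddCircle (T := (1 : ℝ)))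
      = (-1) ^ i * fourierCoefficient f i := by
  conv_lhs => rw [← measurePreserving_toCircleMap.map_eq]
  rw [integral_map measurePreserving_toCircleMap.measurable.aemeasurable, fourierCoefficient,
    ← integral_const_mul]
  · refine integral_congr_ae (ae_of_all _ fun x => ?_)
    simp only
    rw [fourier_toCircleMap, ofCircleMap_toCircleMap, conj_e]
    ring
  · rw [measurePreserving_toCircleMap.map_eq]
    exact (map_continuous (fourier i)).aestronglyMeasurable.mul
      (hf.comp_measurePreserving measurePreserving_ofCircleMap)

/-- Parseval's formula for the bilinear pairing of `L²(μ)`. -/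
theorem hasSum_fourierCoefficient_mul {f g : ℝ → ℂ} (hf : MemLp f 2 mu) (hg : MemLp g 2 mu) :
    HasSum (fun m : ℤ => fourierCoefficient f m * fourierCoefficient g (-m))
      (∫ t, f t * g t ∂mu) := by
  -- Conjugating f turns the sesquilinear inner product into the bilinear pairing ∫ f g, which is
  -- why the indices m and -m are paired. The signs `(-1) ^ i` from the two coefficients cancel.
  have hfc : MemLp (fun y => (starRingEnd ℂ) (f (ofCircleMap y))) 2
      (AddCircle.haarAddCircle (T := (1 : ℝ))) :=
    (hf.comp_measurePreserving measurePreserving_ofCircleMap).star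
  have hgc : MemLp (fun y => g (ofCircleMap y)) 2 (AddCircle.haarAddCircle (T := (1 : ℝ))) :=
    hg.comp_measurePreserving measurePreserving_ofCircleMap
  have h := (fourierBasis (T := (1 : ℝ))).hasSum_inner_mul_inner (hfc.toLp _) (hgc.toLp _)
  have hinner : inner ℂ (hfc.toLp _) (hgc.toLp _) = ∫ t, f t * g t ∂mu := by
    rw [MeasureTheory.L2.inner_def, ← measurePreserving_ofCircleMap.map_eq,
      integral_map measurable_ofCircleMap.aemeasurable]
    · refine integral_congr_ae ?_
      filter_upwards [hfc.coeFn_toLp, hgc.coeFn_toLp] with y h1 h2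
      rw [h1, h2, RCLike.inner_apply, Complex.conj_conj, mul_comm]
    · rw [measurePreserving_ofCircleMap.map_eq]
      exact hf.aestronglyMeasurable.mul hg.aestronglyMeasurable
  rw [hinner] at h
  refine h.congr_fun ?_
  intro i
  have h1 : inner ℂ (hfc.toLp _) (fourierBasis (T := (1 : ℝ)) i)
      = (-1) ^ i * fourierCoefficient f i := by
    rw [← integral_mul_e_neg_eq hf.aestronglyMeasurable, MeasureTheory.L2.inner_def]
    refine integral_congr_ae ?_
    rw [coe_fourierBasis]
    filter_upwards [hfc.coeFn_toLp, coeFn_fourierLp (T := (1 : ℝ)) 2 i] with y h1 h2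
    rw [h1, h2, RCLike.inner_apply, Complex.conj_conj]
  have h2 : inner ℂ (fourierBasis (T := (1 : ℝ)) i) (hgc.toLp _)
      = (-1) ^ i * fourierCoefficient g (-i) := by
    have h3 := integral_mul_e_neg_eq hg.aestronglyMeasurable (-i)
    have h4 : ((-1) ^ (-i) : ℂ) = (-1) ^ i := by
      rw [zpow_neg, ← inv_zpow]; norm_num
    rw [h4] at h3
    rw [← h3, MeasureTheory.L2.inner_def]
    refine integral_congr_ae ?_
    rw [coe_fourierBasis]
    filter_upwards [hgc.coeFn_toLp, coeFn_fourierLp (T := (1 : ℝ)) 2 i] with y h1 h2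
    rw [h1, h2, RCLike.inner_apply, fourier_neg, mul_comm]
  rw [h1, h2]
  have h5 : ((-1) ^ i * (-1) ^ i : ℂ) = 1 := by
    rw [← mul_zpow]; norm_num
  linear_combination (-fourierCoefficient f i * fourierCoefficient g (-i)) * h5

theorem fourierCoefficient_e (m n : ℤ) :
    fourierCoefficient (e n) m = if m = n then 1 else 0 := by
  have h := integral_mul_e_neg_eq (memLp_e (n - m)).aestronglyMeasurable 0
  have h1 : fourierCoefficient (e n) m = fourierCoefficient (e (n - m)) 0 := by
    unfold fourierCoefficient
    congr 1; ext t
    rw [conj_e, conj_e, ← e_add, neg_zero, e_zero, mul_one, sub_eq_add_neg]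
  rw [h1]
  have h2 : fourierCoefficient (e (n - m)) 0
      = (-1) ^ (m - n) * ∫ y, (fourier (m - n) y : ℂ) ∂(AddCircle.haarAddCircle (T := (1 : ℝ))) := by
    have h3 := integral_mul_e_neg_eq (f := fun _ => 1) aestronglyMeasurable_const (m - n)
    simp only [mul_one] at h3
    have h5 : ((-1) ^ (m - n) * (-1) ^ (m - n) : ℂ) = 1 := by
      rw [← mul_zpow]; norm_num
    rw [h3, ← mul_assoc, h5, one_mul]
    unfold fourierCoefficient
    congr 1; ext t
    rw [conj_e, conj_e, neg_zero, e_zero, mul_one, one_mul, neg_sub]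
  rw [h2]
  have ho := orthonormal_iff_ite.1 (orthonormal_fourier (T := (1 : ℝ))) n m
  rw [ContinuousMap.inner_toLp (𝕜 := ℂ) AddCircle.haarAddCircle (fourier n) (fourier m)] at ho
  have h4 : ∫ y, (fourier (m - n) y : ℂ) ∂(AddCircle.haarAddCircle (T := (1 : ℝ)))
      = if n = m then 1 else 0 := by
    rw [← ho]
    congr 1; ext y
    rw [sub_eq_add_neg, fourier_add, fourier_neg]
  rw [h4]
  by_cases hmn : m = n
  · simp [hmn]
  · simp [hmn, Ne.symm hmn]

/-! ### Fourier coefficients of exponentials -/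

theorem integral_mu {E : Type*} [NormedAddCommGroup E] [NormedSpace ℝ E] (F : ℝ → E) :
    ∫ t, F t ∂mu = ∫ t, (1 / (2 * Real.pi) * (1 / (1 / 4 + t ^ 2))) • F t := by
  rw [mu_eq_withDensity, integral_withDensity_eq_integral_toReal_smul (by fun_prop)
    (ae_of_all _ fun _ => ENNReal.ofReal_lt_top)]
  refine integral_congr_ae (ae_of_all _ fun t => ?_)
  simp only
  rw [ENNReal.toReal_ofReal (by positivity)]

theorem integrable_mu_iff {E : Type*} [NormedAddCommGroup E] [NormedSpace ℝ E] {F : ℝ → E} :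
    Integrable F mu ↔ Integrable fun t => (1 / (2 * Real.pi) * (1 / (1 / 4 + t ^ 2))) • F t := by
  rw [mu_eq_withDensity, integrable_withDensity_iff_integrable_smul' (by fun_prop)
    (ae_of_all _ fun _ => ENNReal.ofReal_lt_top)]
  refine integrable_congr (ae_of_all _ fun t => ?_)
  simp only
  rw [ENNReal.toReal_ofReal (by positivity)]

theorem integrable_density :
    Integrable fun t : ℝ => 1 / (2 * Real.pi) * (1 / (1 / 4 + t ^ 2)) := by
  simpa using integrable_mu_iff.1 (integrable_const (1 : ℝ))

-- Computed on the two half-lines separately. This direction is an elementary integral; Fourier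
-- inversion then gives the characteristic function of μ without residues.
open FourierTransform in
theorem fourier_exp_neg_pi_abs :
    𝓕 (fun x : ℝ => ((Real.exp (-Real.pi * |x|) : ℝ) : ℂ))
      = fun t : ℝ => ((1 / (2 * Real.pi) * (1 / (1 / 4 + t ^ 2)) : ℝ) : ℂ) := by
  ext t
  have hpi := Real.pi_pos
  set a : ℂ := -Real.pi - 2 * Real.pi * t * Complex.I with ha
  set b : ℂ := Real.pi - 2 * Real.pi * t * Complex.I with hb
  have hare : a.re < 0 := by simp [ha, hpi]
  have hbre : 0 < b.re := by simp [hb, hpi]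
  rw [Real.fourier_real_eq_integral_exp_smul]
  have h1 : ∀ x ∈ Set.Ioi (0 : ℝ), Complex.exp (↑(-2 * Real.pi * x * t) * Complex.I) •
      ((Real.exp (-Real.pi * |x|) : ℝ) : ℂ) = Complex.exp (a * x) := by
    intro x hx
    rw [abs_of_pos hx, smul_eq_mul, Complex.ofReal_exp, ← Complex.exp_add, ha]
    push_cast
    ring_nf
  have h2 : ∀ x ∈ Set.Iic (0 : ℝ), Complex.exp (↑(-2 * Real.pi * x * t) * Complex.I) •
      ((Real.exp (-Real.pi * |x|) : ℝ) : ℂ) = Complex.exp (b * x) := by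
    intro x hx
    rw [abs_of_nonpos hx, smul_eq_mul, Complex.ofReal_exp, ← Complex.exp_add, hb]
    push_cast
    ring_nf
  have hi1 := integrableOn_exp_mul_complex_Ioi hare 0
  have hi2 := integrableOn_exp_mul_complex_Iic hbre 0
  rw [← intervalIntegral.integral_Iic_add_Ioi (b := 0), setIntegral_congr_fun measurableSet_Ioi h1,
    setIntegral_congr_fun measurableSet_Iic h2, integral_exp_mul_complex_Ioi hare,
    integral_exp_mul_complex_Iic hbre]
  · have ha0 : a ≠ 0 := fun h => by simp [h] at hare
    have hb0 : b ≠ 0 := fun h => by simp [h] at hbre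
    have ht : ((1 / 4 + t ^ 2 : ℝ) : ℂ) ≠ 0 := Complex.ofReal_ne_zero.2 (by positivity)
    have hpi' : (Real.pi : ℂ) ≠ 0 := Complex.ofReal_ne_zero.2 hpi.ne'
    have hab : b * -a = 4 * Real.pi ^ 2 * (1 / 4 + t ^ 2 : ℝ) := by
      rw [ha, hb]; push_cast
      linear_combination (-4 * Real.pi ^ 2 * t ^ 2 : ℂ) * Complex.I_sq
    have hsum : b - a = 2 * Real.pi := by rw [ha, hb]; ring
    have : Complex.exp (b * (0 : ℝ)) / b + -Complex.exp (a * (0 : ℝ)) / a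
        = (b - a) / (b * -a) := by
      simp only [Complex.ofReal_zero, mul_zero, Complex.exp_zero]
      field_simp
      ring
    rw [this, hab, hsum]
    rw [Complex.ofReal_mul, Complex.ofReal_div 1 (1 / 4 + t ^ 2)]
    push_cast at ht ⊢
    field_simp
    ring
  · exact hi2.congr_fun (fun x hx => (h2 x hx).symm) measurableSet_Iic
  · exact hi1.congr_fun (fun x hx => (h1 x hx).symm) measurableSet_Ioi

open FourierTransform in
/-- The characteristic function of the Cauchy distribution with scale `1/2`. -/
theorem integral_exp_mul_I_mu (v : ℝ) :
    ∫ t, Complex.exp ((2 * Real.pi * (t * v) : ℝ) * Complex.I) ∂mu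
      = Real.exp (-Real.pi * |v|) := by
  have hpi := Real.pi_pos
  have hc : Continuous fun x : ℝ => ((Real.exp (-Real.pi * |x|) : ℝ) : ℂ) := by fun_prop
  have hint : Integrable fun x : ℝ => ((Real.exp (-Real.pi * |x|) : ℝ) : ℂ) := by
    refine Integrable.ofReal ?_
    have h1 : IntegrableOn (fun x : ℝ => Real.exp (-Real.pi * |x|)) (Set.Ioi 0) :=
      (integrableOn_exp_mul_Ioi (neg_neg_of_pos hpi) 0).congr_fun
        (fun x hx => by simp only; rw [abs_of_pos hx]) measurableSet_Ioi
    have h2 : IntegrableOn (fun x : ℝ => Real.exp (-Real.pi * |x|)) (Set.Iic 0) :=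
      (integrableOn_exp_mul_Iic hpi 0).congr_fun
        (fun x hx => by simp only; rw [abs_of_nonpos hx]; ring_nf) measurableSet_Iic
    rw [← integrableOn_univ, ← Set.Iic_union_Ioi (a := (0 : ℝ))]
    exact h2.union h1
  have h := congrFun (hc.fourierInv_fourier_eq hint
    (by rw [fourier_exp_neg_pi_abs]; exact integrable_density.ofReal)) v
  rw [fourier_exp_neg_pi_abs, Real.fourierInv_eq'] at h
  rw [integral_mu, ← h]
  refine integral_congr_ae (ae_of_all _ fun t => ?_)
  simp only [smul_eq_mul, RCLike.inner_apply, conj_trivial, Complex.real_smul]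
  rw [mul_comm, mul_comm t v]

theorem integrable_of_continuous_of_bound {F : ℝ → ℂ} (hF : Continuous F) {C : ℝ}
    (hC : ∀ t, ‖F t‖ ≤ C) : Integrable F mu :=
  Integrable.of_bound hF.aestronglyMeasurable C (ae_of_all _ hC)

theorem norm_exp_mul_le {l : ℂ} (hl : |l.re| ≤ 1 / 2) (v : ℝ) :
    ‖Complex.exp (l * v)‖ ≤ Real.exp (1 / 2 * |v|) := by
  rw [Complex.norm_exp, Complex.re_mul_ofReal]
  refine Real.exp_le_exp.2 ((le_abs_self _).trans ?_)
  rw [abs_mul]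
  gcongr

/-- Justifies Fubini between `v` in a bounded interval and `t` under μ: the bound on the real part
of `l` keeps the integrand bounded. -/
theorem integrable_prod_exp {l h : ℝ → ℂ} (hl : Continuous l) (hh : Continuous h)
    (hre : ∀ t, |(l t).re| ≤ 1 / 2) (hh1 : ∀ t, ‖h t‖ ≤ 1) (a b : ℝ) :
    Integrable (Function.uncurry fun (v t : ℝ) => Complex.exp (l t * v) * h t)
      ((volume.restrict (Set.uIoc a b)).prod mu) := by
  have : IsFiniteMeasure (volume.restrict (Set.uIoc a b)) := ⟨by simp [Set.uIoc]⟩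
  refine Integrable.of_bound (C := Real.exp (1 / 2 * (|a| + |b|))) ?_ ?_
  · refine Continuous.aestronglyMeasurable ?_
    simp only [Function.uncurry_def]
    fun_prop
  · have : ∀ᵐ p : ℝ × ℝ ∂((volume.restrict (Set.uIoc a b)).prod mu), p.1 ∈ Set.uIoc a b :=
      Measure.quasiMeasurePreserving_fst.ae (ae_restrict_mem measurableSet_uIoc)
    filter_upwards [this] with p hp
    have hp2 : |p.1| ≤ |a| + |b| := by
      rcases Set.mem_uIoc.1 hp with ⟨h1, h2⟩ | ⟨h1, h2⟩ <;> rw [abs_le] <;>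
      constructor <;> linarith [neg_abs_le a, le_abs_self a, neg_abs_le b, le_abs_self b,
        abs_nonneg a, abs_nonneg b]
    simp only [Function.uncurry_def, norm_mul]
    calc _ ≤ Real.exp (1 / 2 * |p.1|) * 1 := by
          gcongr
          · exact norm_exp_mul_le (hre _) _
          · exact hh1 _
      _ ≤ _ := by rw [mul_one]; gcongr

/-- Integration by parts for the averages of `exp (l u) * h`, when `r + 1 = σ / l`. -/
theorem integral_exp_mul_recurrence {l r h : ℝ → ℂ} (hl : Continuous l) (hr : Continuous r)
    (hh : Continuous h) (hre : ∀ t, |(l t).re| ≤ 1 / 2) (hl0 : ∀ t, l t ≠ 0)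
    (hr1 : ∀ t, ‖r t‖ ≤ 1) (hh1 : ∀ t, ‖h t‖ ≤ 1) (σ : ℂ) (hσ : ∀ t, r t + 1 = σ / l t) (u : ℝ) :
    ∫ t, Complex.exp (l t * u) * (r t * h t) ∂mu =
      -∫ t, Complex.exp (l t * u) * h t ∂mu +
      σ * (∫ v in (0 : ℝ)..u, ∫ t, Complex.exp (l t * v) * h t ∂mu) +
      (∫ t, r t * h t ∂mu + ∫ t, h t ∂mu) := by
  rw [intervalIntegral_integral_swap (integrable_prod_exp hl hh hre hh1 0 u)]
  have hb : ∀ t, ‖Complex.exp (l t * u)‖ ≤ Real.exp (1 / 2 * |u|) := fun t =>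
    norm_exp_mul_le (hre t) u
  have i0 : Integrable (fun t => Complex.exp (l t * u) * (r t * h t)) mu :=
    integrable_of_continuous_of_bound (C := Real.exp (1 / 2 * |u|) * (1 * 1)) (by fun_prop) fun t => by
      rw [norm_mul, norm_mul]
      gcongr
      exacts [hb t, hr1 t, hh1 t]
  have i1 : Integrable (fun t => Complex.exp (l t * u) * h t) mu :=
    integrable_of_continuous_of_bound (C := Real.exp (1 / 2 * |u|) * 1) (by fun_prop) fun t => by
      rw [norm_mul]
      gcongr
      exacts [hb t, hh1 t]
  have i2 : Integrable (fun t => r t * h t) mu :=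
    integrable_of_continuous_of_bound (C := 1 * 1) (by fun_prop) fun t => by
      rw [norm_mul]
      gcongr
      exacts [hr1 t, hh1 t]
  have i3 : Integrable h mu := integrable_of_continuous_of_bound hh hh1
  -- Since σ / l = r + 1, the left side equals (r + 1)(exp(l u) - 1) h.
  have hpt : ∀ t, σ * ∫ v in (0 : ℝ)..u, Complex.exp (l t * v) * h t
      = Complex.exp (l t * u) * (r t * h t) + Complex.exp (l t * u) * h t - (r t * h t + h t) := by
    intro t
    rw [intervalIntegral.integral_mul_const, integral_exp_mul_complex (hl0 t)]
    simp only [Complex.ofReal_zero, mul_zero, Complex.exp_zero]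
    have := hσ t
    have h1 := hl0 t
    have h2 : σ = (r t + 1) * l t := by rw [this]; field_simp
    rw [h2]
    field_simp
  have hsplit : ∫ t, (Complex.exp (l t * u) * (r t * h t) + Complex.exp (l t * u) * h t -
      (r t * h t + h t)) ∂mu = (∫ t, Complex.exp (l t * u) * (r t * h t) ∂mu +
      ∫ t, Complex.exp (l t * u) * h t ∂mu) - (∫ t, r t * h t ∂mu + ∫ t, h t ∂mu) := by
    rw [← integral_add i0 i1, ← integral_add i2 i3]
    exact integral_sub (i0.add i1) (i2.add i3)
  rw [← integral_const_mul, integral_congr_ae (ae_of_all _ hpt), hsplit]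
  ring

/-! ### Fourier coefficients of exp((1 - s)u): vanishing and Laguerre polynomials -/

/-- The average `∫ exp ((1 - s) u) e_{-n} dμ` along the critical line `s = 1/2 + it`. -/
noncomputable def expCoeff (n : ℤ) (u : ℝ) : ℂ :=
  ∫ t, Complex.exp ((1 / 2 - Complex.I * t) * u) * e (-n) t ∂mu

theorem integral_e (n : ℤ) : ∫ t, e n t ∂mu = if n = 0 then 1 else 0 := by
  have h := fourierCoefficient_e 0 n
  unfold fourierCoefficient at h
  simp only [e_zero, map_one, mul_one] at h
  rw [h]
  simp only [eq_comm]

theorem e_one (t : ℝ) : e 1 t = (1 / 2 - Complex.I * t) / (1 / 2 + Complex.I * t) := by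
  rw [e, zpow_one]

theorem e_neg_one (t : ℝ) : e (-1) t = (1 / 2 + Complex.I * t) / (1 / 2 - Complex.I * t) := by
  rw [e, zpow_neg_one, inv_div]

/-- The factor exp(u/2) cancels the characteristic function exp(-|u|/2); the sign of `u` is
essential. -/
theorem expCoeff_zero {u : ℝ} (hu : 0 ≤ u) : expCoeff 0 u = 1 := by
  have hpi := Real.pi_pos
  have h := integral_exp_mul_I_mu (-(u / (2 * Real.pi)))
  have h1 : expCoeff 0 u = Complex.exp (u / 2) *
      ∫ t, Complex.exp ((2 * Real.pi * (t * (-(u / (2 * Real.pi)))) : ℝ) * Complex.I) ∂mu := by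
    rw [expCoeff, ← integral_const_mul]
    refine integral_congr_ae (ae_of_all _ fun t => ?_)
    simp only [neg_zero, e_zero, mul_one]
    rw [← Complex.exp_add]
    congr 1
    have : 2 * Real.pi * (t * (-(u / (2 * Real.pi)))) = -(t * u) := by field_simp
    rw [this]
    push_cast
    ring
  rw [h1, h, Complex.ofReal_exp, ← Complex.exp_add, abs_neg, abs_of_nonneg (by positivity)]
  have : -Real.pi * (u / (2 * Real.pi)) = -(u / 2) := by field_simp
  rw [this]
  push_cast
  simp

/-- The recurrence `integral_exp_mul_recurrence` with r = e_{-1} and σ = 1, because e_{-1} + 1 = 1 /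
(1/2 - it). -/
theorem expCoeff_succ (n : ℤ) (u : ℝ) :
    expCoeff (n + 1) u = -expCoeff n u + (∫ v in (0 : ℝ)..u, expCoeff n v) +
      ((if n + 1 = 0 then 1 else 0) + if n = 0 then 1 else 0) := by
  have h := integral_exp_mul_recurrence (l := fun t => 1 / 2 - Complex.I * t) (r := e (-1))
    (h := e (-n)) (by fun_prop) (continuous_e _) (continuous_e _) (fun t => by simp [abs_of_pos])
    half_sub_ne_zero (fun t => (norm_e _ t).le) (fun t => (norm_e _ t).le) 1
    (fun t => by
      rw [e_neg_one, div_add_one (half_sub_ne_zero t)]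
      ring) u
  simp only [← e_add, one_mul, integral_e] at h
  simp only [show (-1 + -n : ℤ) = -(n + 1) by ring, neg_eq_zero] at h
  exact h

/-- Multiplying by exp(-u) changes the exponent 1/2 - it into -(1/2 + it). Then e_1 + 1 = 1 / (1/2 +
it) yields a recurrence that lowers the index, and the induction starts from -exp(-u) - (1 -
exp(-u)) + 1 = 0. -/
theorem expCoeff_neg (n : ℕ) {u : ℝ} (hu : 0 ≤ u) : expCoeff (-(n + 1 : ℕ)) u = 0 := by
  have key : ∀ (m : ℤ) (u : ℝ), Complex.exp (-u) * expCoeff m u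
      = ∫ t, Complex.exp (-(1 / 2 + Complex.I * t) * u) * e (-m) t ∂mu := by
    intro m u
    rw [expCoeff, ← integral_const_mul]
    refine integral_congr_ae (ae_of_all _ fun t => ?_)
    simp only
    rw [← mul_assoc, ← Complex.exp_add]
    congr 2
    ring
  have hrec : ∀ (m : ℤ) (u : ℝ), Complex.exp (-u) * expCoeff (m - 1) u
      = -(Complex.exp (-u) * expCoeff m u) - (∫ v in (0 : ℝ)..u, Complex.exp (-v) * expCoeff m v) +
        ((if m - 1 = 0 then 1 else 0) + if m = 0 then 1 else 0) := by
    intro m u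
    have h := integral_exp_mul_recurrence (l := fun t => -(1 / 2 + Complex.I * t)) (r := e 1)
      (h := e (-m)) (by fun_prop) (continuous_e _) (continuous_e _)
      (fun t => by simp [abs_of_pos])
      (fun t => neg_ne_zero.2 (half_add_ne_zero t)) (fun t => (norm_e _ t).le)
      (fun t => (norm_e _ t).le) (-1)
      (fun t => by
        rw [e_one, div_add_one (half_add_ne_zero t), div_neg, ← neg_div, neg_neg]
        ring) u
    simp only [← e_add, neg_one_mul, integral_e] at h
    simp only [show (1 + -m : ℤ) = -(m - 1) by ring, neg_eq_zero] at h
    simp only [← key] at h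
    rw [h]
    ring
  have hexp : ∀ u : ℝ, Complex.exp (-u) ≠ 0 := fun u => Complex.exp_ne_zero _
  suffices h : ∀ u : ℝ, 0 ≤ u → Complex.exp (-u) * expCoeff (-(n + 1 : ℕ)) u = 0 from
    (mul_eq_zero.1 (h u hu)).resolve_left (hexp u)
  clear hu u
  induction n with
  | zero =>
    intro u hu
    have h := hrec 0 u
    have h1 : ∫ v in (0 : ℝ)..u, Complex.exp (-v) * expCoeff 0 v
        = ∫ v in (0 : ℝ)..u, Complex.exp ((-1 : ℂ) * v) := by
      refine intervalIntegral.integral_congr fun v hv => ?_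
      rw [Set.uIcc_of_le hu] at hv
      rw [expCoeff_zero hv.1, mul_one, neg_one_mul]
    rw [h1, integral_exp_mul_complex (by norm_num), expCoeff_zero hu] at h
    simp only [zero_add, Nat.cast_one]
    simp only [zero_sub] at h
    rw [h]
    simp only [Complex.ofReal_zero, mul_zero, Complex.exp_zero]
    norm_num
    ring
  | succ n ih =>
    intro u hu
    have h := hrec (-(n + 1 : ℕ)) u
    have h1 : ∫ v in (0 : ℝ)..u, Complex.exp (-v) * expCoeff (-(n + 1 : ℕ)) v = 0 := by
      rw [intervalIntegral.integral_congr (g := fun _ => (0 : ℂ))]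
      · simp
      · intro v hv
        rw [Set.uIcc_of_le hu] at hv
        exact ih v hv.1
    rw [h1, ih u hu, if_neg (by push_cast; omega), if_neg (by push_cast; omega)] at h
    rw [show (-((n + 1 + 1 : ℕ) : ℤ)) = -((n + 1 : ℕ) : ℤ) - 1 by push_cast; ring, h]
    simp

theorem integral_ofReal_pow (j : ℕ) (u : ℝ) :
    ∫ v in (0 : ℝ)..u, (v : ℂ) ^ j = (u : ℂ) ^ (j + 1) / (j + 1) := by
  have h := congrArg (fun x : ℝ => (x : ℂ)) (integral_pow (a := 0) (b := u) j)
  simp only [← intervalIntegral.integral_ofReal] at h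
  push_cast at h
  rw [h, zero_pow (by omega), sub_zero]

/-- For positive index `expCoeff` is a Laguerre polynomial on the half-line. -/
theorem expCoeff_pos (n : ℕ) {u : ℝ} (hu : 0 ≤ u) :
    expCoeff (n + 1 : ℕ) u = ∑ j ∈ Finset.range (n + 1),
      (n.choose j : ℂ) * (-1) ^ (n + j) * (u ^ (j + 1) / ((j + 1).factorial : ℂ)) := by
  induction n generalizing u with
  | zero =>
    have h := expCoeff_succ 0 u
    have h1 : ∫ v in (0 : ℝ)..u, expCoeff 0 v = ∫ v in (0 : ℝ)..u, (1 : ℂ) := by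
      refine intervalIntegral.integral_congr fun v hv => ?_
      rw [Set.uIcc_of_le hu] at hv
      exact expCoeff_zero hv.1
    rw [h1, expCoeff_zero hu] at h
    simp at h ⊢
    exact h
  | succ n ih =>
    have h := expCoeff_succ (n + 1 : ℕ) u
    have h1 : ∫ v in (0 : ℝ)..u, expCoeff (n + 1 : ℕ) v
        = ∑ j ∈ Finset.range (n + 1),
          (n.choose j : ℂ) * (-1) ^ (n + j) * (u ^ (j + 2) / ((j + 2).factorial : ℂ)) := by
      have h2 : ∫ v in (0 : ℝ)..u, expCoeff (n + 1 : ℕ) v = ∫ v in (0 : ℝ)..u,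
          ∑ j ∈ Finset.range (n + 1),
            (n.choose j : ℂ) * (-1) ^ (n + j) * ((v : ℂ) ^ (j + 1) / ((j + 1).factorial : ℂ)) := by
        refine intervalIntegral.integral_congr fun v hv => ?_
        rw [Set.uIcc_of_le hu] at hv
        exact ih hv.1
      rw [h2, intervalIntegral.integral_finsetSum fun j _ =>
        Continuous.intervalIntegrable (by fun_prop) _ _]
      refine Finset.sum_congr rfl fun j _ => ?_
      have h3 := integral_ofReal_pow (j + 1) u
      rw [intervalIntegral.integral_const_mul, intervalIntegral.integral_div, h3,
        Nat.factorial_succ (j + 1)]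
      have : ((j + 1).factorial : ℂ) ≠ 0 := by exact_mod_cast (j + 1).factorial_ne_zero
      have h5 : (j + 2 : ℂ) ≠ 0 := by exact_mod_cast (by omega : j + 2 ≠ 0)
      push_cast
      rw [show (j + 1 + 1 : ℂ) = j + 2 by ring]
      field_simp
    rw [h1, ih hu, if_neg (by push_cast; omega), if_neg (by push_cast; omega)] at h
    push_cast at h ⊢
    -- What remains is Pascal's rule: `hA` shifts the index of the old sum, and `hB` splits the new
    -- binomial coefficients.
    set X : ℕ → ℂ := fun j => (u : ℂ) ^ (j + 1) / ((j + 1).factorial : ℂ) with hX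
    have hA : ∑ j ∈ Finset.range (n + 1), (n.choose j : ℂ) * (-1) ^ (n + j) * X j
        = ∑ j ∈ Finset.range (n + 1), (n.choose (j + 1) : ℂ) * (-1) ^ (n + (j + 1)) * X (j + 1) +
          (-1) ^ n * X 0 := by
      have := Finset.sum_range_succ' (fun j => (n.choose j : ℂ) * (-1) ^ (n + j) * X j) (n + 1)
      rw [Finset.sum_range_succ _ (n + 1)] at this
      simpa using this
    have hB : ∑ j ∈ Finset.range (n + 1 + 1),
        ((n + 1).choose j : ℂ) * (-1) ^ (n + 1 + j) * X j
        = -∑ j ∈ Finset.range (n + 1), (n.choose (j + 1) : ℂ) * (-1) ^ (n + (j + 1)) * X (j + 1) +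
          ∑ j ∈ Finset.range (n + 1), (n.choose j : ℂ) * (-1) ^ (n + j) * X (j + 1) -
          (-1) ^ n * X 0 := by
      rw [Finset.sum_range_succ' _ (n + 1), ← Finset.sum_neg_distrib, ← Finset.sum_add_distrib,
        sub_eq_add_neg]
      congr 1
      · refine Finset.sum_congr rfl fun j _ => ?_
        rw [Nat.choose_succ_succ]
        push_cast
        ring
      · simp [pow_succ]
    rw [hB, h, hA]
    ring

/-! ### Truncations of the zeta function -/

/-- The function `x ↦ {x}` cut off to `x > a`. -/
noncomputable def fractTail (a : ℝ) : ℝ → ℂ := (Set.Ioi a).indicator fun x => ((Int.fract x : ℝ) : ℂ)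

theorem norm_fractTail_le (a x : ℝ) : ‖fractTail a x‖ ≤ 1 := by
  unfold fractTail
  refine (norm_indicator_le_norm_self _ _).trans ?_
  rw [Complex.norm_real, Real.norm_eq_abs, Int.abs_fract]
  exact (Int.fract_lt_one x).le

theorem measurable_fractTail (a : ℝ) : Measurable (fractTail a) :=
  (Complex.measurable_ofReal.comp measurable_fract).indicator measurableSet_Ioi

theorem locallyIntegrable_fractTail (a : ℝ) : LocallyIntegrable (fractTail a) :=
  (memLp_top_of_bound (measurable_fractTail a).aestronglyMeasurable 1
    (ae_of_all _ (norm_fractTail_le a))).locallyIntegrable le_top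

/-- The integral `∫_{x > a} {x} x^{-s-1} dx`. -/
noncomputable def fractIntegral (a : ℝ) (s : ℂ) : ℂ := mellin (fractTail a) (-s)

theorem fractTail_isBigO_top (a : ℝ) : fractTail a =O[atTop] fun x : ℝ => x ^ (-(0 : ℝ)) := by
  refine Asymptotics.isBigO_of_le _ fun x => ?_
  simp [norm_fractTail_le a x]

theorem fractTail_isBigO_zero {a : ℝ} (ha : 0 < a) (b : ℝ) :
    fractTail a =O[𝓝[>] 0] fun x : ℝ => x ^ (-b) := by
  have h : fractTail a =ᶠ[𝓝[>] 0] fun _ => (0 : ℂ) := by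
    filter_upwards [nhdsWithin_le_nhds (Iio_mem_nhds ha)] with x hx
    exact Set.indicator_of_notMem (fun h => lt_asymm h hx) _
  exact h.trans_isBigO (Asymptotics.isBigO_zero _ _)

theorem mellinConvergent_fractTail {a : ℝ} (ha : 0 < a) {s : ℂ} (hs : 0 < s.re) :
    MellinConvergent (fractTail a) (-s) :=
  mellinConvergent_of_isBigO_rpow ((locallyIntegrable_fractTail a).locallyIntegrableOn _)
    (fractTail_isBigO_top a) (by simpa using hs) (fractTail_isBigO_zero ha ((-s).re - 1)) (by linarith)

theorem differentiableAt_fractIntegral {a : ℝ} (ha : 0 < a) {s : ℂ} (hs : 0 < s.re) :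
    DifferentiableAt ℂ (fractIntegral a) s := by
  have h : DifferentiableAt ℂ (mellin (fractTail a)) (-s) :=
    mellin_differentiableAt_of_isBigO_rpow ((locallyIntegrable_fractTail a).locallyIntegrableOn _)
      (fractTail_isBigO_top a) (by simpa using hs) (fractTail_isBigO_zero ha ((-s).re - 1))
      (by linarith)
  exact h.comp s differentiableAt_id.neg

theorem mellin_fractTail_integrand {a : ℝ} (ha : 0 < a) (s : ℂ) :
    (Set.Ioi (0 : ℝ)).indicator (fun x : ℝ => (x : ℂ) ^ (-s - 1) • fractTail a x)
      = (Set.Ioi a).indicator fun x : ℝ => (x : ℂ) ^ (-s - 1) * (Int.fract x : ℝ) := by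
  ext x
  by_cases hx : a < x
  · rw [Set.indicator_of_mem (Set.mem_Ioi.2 (ha.trans hx)), Set.indicator_of_mem (Set.mem_Ioi.2 hx),
      fractTail, Set.indicator_of_mem (Set.mem_Ioi.2 hx), smul_eq_mul]
  · rw [Set.indicator_of_notMem (s := Set.Ioi a) (by simpa using hx)]
    by_cases h0 : 0 < x
    · rw [Set.indicator_of_mem (Set.mem_Ioi.2 h0), fractTail, Set.indicator_of_notMem (by simpa using hx),
        smul_zero]
    · rw [Set.indicator_of_notMem (by simpa using h0)]

theorem fractIntegral_eq {a : ℝ} (ha : 0 < a) (s : ℂ) :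
    fractIntegral a s = ∫ x in Set.Ioi a, (x : ℂ) ^ (-s - 1) * (Int.fract x : ℝ) := by
  rw [fractIntegral, mellin, ← integral_indicator measurableSet_Ioi, mellin_fractTail_integrand ha,
    integral_indicator measurableSet_Ioi]

theorem integrableOn_fract {a : ℝ} (ha : 0 < a) {s : ℂ} (hs : 0 < s.re) :
    IntegrableOn (fun x : ℝ => (x : ℂ) ^ (-s - 1) * (Int.fract x : ℝ)) (Set.Ioi a) := by
  have h := mellinConvergent_fractTail ha hs
  rw [MellinConvergent, ← integrable_indicator_iff measurableSet_Ioi, mellin_fractTail_integrand ha,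
    integrable_indicator_iff measurableSet_Ioi] at h
  exact h

/-- The truncation `∑_{m ≤ N} m^{-s} - ∫_1^N x^{-s} dx` of `ζ(s) - 1 / (s - 1)`, with the integral
written in the variable `log x`. -/
noncomputable def zetaTruncation (N : ℕ) (s : ℂ) : ℂ :=
  ∑ m ∈ Finset.Icc 1 N, (m : ℂ) ^ (-s) - ∫ v in (0 : ℝ)..Real.log N, Complex.exp ((1 - s) * v)

theorem zetaTruncation_eq {N : ℕ} (hN : 1 ≤ N) {s : ℂ} (hs : s ≠ 1) :
    zetaTruncation N s = ∑ m ∈ Finset.Icc 1 N, (m : ℂ) ^ (-s) - ((N : ℂ) ^ (1 - s) - 1) / (1 - s) := by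
  have h1 : 1 - s ≠ 0 := sub_ne_zero.2 hs.symm
  have hN0 : (N : ℂ) ≠ 0 := by exact_mod_cast (by omega : N ≠ 0)
  rw [zetaTruncation, integral_exp_mul_complex h1, Complex.cpow_def_of_ne_zero hN0]
  simp [mul_comm]

theorem integral_cpow_mul_fract {N : ℕ} (hN : 1 ≤ N) {s : ℂ} (hs : s ≠ 1) (hs0 : s ≠ 0) :
    s * ∫ x in Set.Ioc (N : ℝ) ((N + 1 : ℕ) : ℝ), (x : ℂ) ^ (-s - 1) * (Int.fract x : ℝ)
      = s * (((N + 1 : ℕ) : ℂ) ^ (1 - s) - (N : ℂ) ^ (1 - s)) / (1 - s) +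
        N * (((N + 1 : ℕ) : ℂ) ^ (-s) - (N : ℂ) ^ (-s)) := by
  have hN1 : (0 : ℝ) < N := by exact_mod_cast hN
  have hle : (N : ℝ) ≤ ((N + 1 : ℕ) : ℝ) := by exact_mod_cast Nat.le_succ N
  have h0 : (0 : ℝ) ∉ Set.uIcc (N : ℝ) ((N + 1 : ℕ) : ℝ) := by
    rw [Set.uIcc_of_le hle]
    exact fun h => absurd h.1 (not_le.2 hN1)
  have h1 : 1 - s ≠ 0 := sub_ne_zero.2 hs.symm
  have hcongr : ∫ x in Set.Ioc (N : ℝ) ((N + 1 : ℕ) : ℝ), (x : ℂ) ^ (-s - 1) * (Int.fract x : ℝ)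
      = ∫ x in (N : ℝ)..((N + 1 : ℕ) : ℝ), ((x : ℂ) ^ (-s) - N * (x : ℂ) ^ (-s - 1)) := by
    rw [intervalIntegral.integral_of_le hle, integral_Ioc_eq_integral_Ioo,
      integral_Ioc_eq_integral_Ioo]
    refine setIntegral_congr_fun measurableSet_Ioo fun x hx => ?_
    have hx0 : (x : ℂ) ≠ 0 := Complex.ofReal_ne_zero.2 (hN1.trans hx.1).ne'
    have hf : Int.fract x = x - N := by
      rw [Int.fract_eq_iff]
      refine ⟨by linarith [hx.1], by have := hx.2; push_cast at this; linarith, N, by push_cast; ring⟩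
    rw [hf, Complex.cpow_sub _ _ hx0, Complex.cpow_one]
    push_cast
    field_simp
  have hi1 : IntervalIntegrable (fun x : ℝ => (x : ℂ) ^ (-s)) volume N ((N + 1 : ℕ) : ℝ) :=
    intervalIntegral.intervalIntegrable_cpow (Or.inr h0)
  have hi2 : IntervalIntegrable (fun x : ℝ => (N : ℂ) * (x : ℂ) ^ (-s - 1)) volume N
      ((N + 1 : ℕ) : ℝ) :=
    (intervalIntegral.intervalIntegrable_cpow (Or.inr h0)).const_mul _
  rw [hcongr, intervalIntegral.integral_sub hi1 hi2, intervalIntegral.integral_const_mul,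
    integral_cpow (Or.inr ⟨fun h => h1 (by linear_combination h), h0⟩),
    integral_cpow (Or.inr ⟨fun h => hs0 (by linear_combination -h), h0⟩)]
  rw [show -s + 1 = 1 - s by ring, show -s - 1 + 1 = -s by ring]
  push_cast
  field_simp
  ring

/-- One step of Euler–Maclaurin summation: the difference does not depend on N, so its value can be
read off at N = 1 or as N → ∞. -/
theorem zetaTruncation_succ_sub {N : ℕ} (hN : 1 ≤ N) {s : ℂ} (hs : s ≠ 1) (hs0 : 0 < s.re) :
    zetaTruncation (N + 1) s - s * fractIntegral ((N + 1 : ℕ) : ℝ) s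
      = zetaTruncation N s - s * fractIntegral N s := by
  have hN1 : (0 : ℝ) < N := by exact_mod_cast hN
  have hle : (N : ℝ) ≤ ((N + 1 : ℕ) : ℝ) := by exact_mod_cast Nat.le_succ N
  have hs00 : s ≠ 0 := fun h => by simp [h] at hs0
  have h1 : 1 - s ≠ 0 := sub_ne_zero.2 hs.symm
  have hsplit : fractIntegral N s
      = (∫ x in Set.Ioc (N : ℝ) ((N + 1 : ℕ) : ℝ), (x : ℂ) ^ (-s - 1) * (Int.fract x : ℝ)) +
        fractIntegral ((N + 1 : ℕ) : ℝ) s := by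
    rw [fractIntegral_eq hN1, fractIntegral_eq (hN1.trans_le hle), ← Set.Ioc_union_Ioi_eq_Ioi hle]
    have hi := integrableOn_fract hN1 hs0
    exact setIntegral_union (Set.Ioc_disjoint_Ioi le_rfl) measurableSet_Ioi
      (hi.mono_set Set.Ioc_subset_Ioi_self) (hi.mono_set (Set.Ioi_subset_Ioi hle))
  have hI := integral_cpow_mul_fract hN hs hs00
  have hpow : ∀ M : ℕ, 1 ≤ M → (M : ℂ) ^ (1 - s) = M * (M : ℂ) ^ (-s) := fun M hM => by
    have hM0 : (M : ℂ) ≠ 0 := by exact_mod_cast (by omega : M ≠ 0)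
    rw [sub_eq_add_neg, Complex.cpow_add _ _ hM0, Complex.cpow_one]
  rw [hsplit, mul_add, hI, zetaTruncation_eq hN hs, zetaTruncation_eq (by omega) hs,
    Finset.sum_Icc_succ_top (by omega), hpow N hN, hpow (N + 1) (by omega)]
  push_cast
  field_simp
  ring

theorem zetaTruncation_sub_eq {N : ℕ} (hN : 1 ≤ N) {s : ℂ} (hs : s ≠ 1) (hs0 : 0 < s.re) :
    zetaTruncation N s - s * fractIntegral N s = zetaTruncation 1 s - s * fractIntegral 1 s := by
  induction N, hN using Nat.le_induction with
  | base => simp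
  | succ N hN ih => rw [zetaTruncation_succ_sub hN hs hs0, ih]

theorem tendsto_fractIntegral {s : ℂ} (hs0 : 0 < s.re) :
    Tendsto (fun N : ℕ => fractIntegral N s) atTop (𝓝 0) := by
  have hi := integrableOn_fract one_pos hs0
  have h : Tendsto (fun N : ℕ => ∫ x in Set.Ioi (1 : ℝ), (Set.Ioi (N : ℝ)).indicator
      (fun x : ℝ => (x : ℂ) ^ (-s - 1) * (Int.fract x : ℝ)) x) atTop
      (𝓝 (∫ x in Set.Ioi (1 : ℝ), (0 : ℂ))) := by
    refine tendsto_integral_of_dominated_convergence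
      (fun x => ‖(x : ℂ) ^ (-s - 1) * (Int.fract x : ℝ)‖)
      (fun N => hi.aestronglyMeasurable.indicator measurableSet_Ioi) hi.norm
      (fun N => ae_of_all _ fun x => norm_indicator_le_norm_self _ _) (ae_of_all _ fun x => ?_)
    refine tendsto_const_nhds.congr' ?_
    obtain ⟨N, hN⟩ := exists_nat_ge x
    filter_upwards [eventually_ge_atTop N] with n hn
    rw [Set.indicator_of_notMem]
    have : (N : ℝ) ≤ n := by exact_mod_cast hn
    simp only [Set.mem_Ioi, not_lt]
    linarith
  rw [integral_zero] at h
  refine h.congr' ?_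
  filter_upwards [eventually_ge_atTop 1] with N hN
  have hN1 : (1 : ℝ) ≤ N := by exact_mod_cast hN
  rw [fractIntegral_eq (by linarith), setIntegral_indicator measurableSet_Ioi,
    Set.Ioi_inter_Ioi, sup_eq_right.2 hN1]

theorem zetaTruncation_eq_of_one_lt_re {s : ℂ} (hs : 1 < s.re) :
    riemannZeta s - 1 / (s - 1) = zetaTruncation 1 s - s * fractIntegral 1 s := by
  have hs1 : s ≠ 1 := fun h => by simp [h] at hs
  have hs0 : 0 < s.re := one_pos.trans hs
  have h1 : 1 - s ≠ 0 := sub_ne_zero.2 hs1.symm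
  have hsum : Tendsto (fun N : ℕ => ∑ m ∈ Finset.Icc 1 N, (m : ℂ) ^ (-s)) atTop
      (𝓝 (riemannZeta s)) := by
    have hsm : Summable fun n : ℕ => 1 / ((n : ℂ) ^ s) := Complex.summable_one_div_nat_cpow.2 hs
    have h := hsm.hasSum.tendsto_sum_nat
    rw [← zeta_eq_tsum_one_div_nat_cpow hs] at h
    refine ((tendsto_add_atTop_iff_nat 1).2 h).congr fun N => ?_
    have hs00 : s ≠ 0 := fun h => by simp [h] at hs0
    rw [Finset.sum_range_succ', Finset.range_eq_Ico,
      Finset.sum_Ico_add' (fun m : ℕ => 1 / ((m : ℂ) ^ s)) 0 N 1]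
    simp only [Nat.cast_zero, Complex.zero_cpow hs00, div_zero, add_zero, zero_add]
    refine Finset.sum_congr (by ext; simp) fun m _ => ?_
    rw [Complex.cpow_neg, one_div]
  have hpow : Tendsto (fun N : ℕ => (N : ℂ) ^ (1 - s)) atTop (𝓝 0) := by
    rw [tendsto_zero_iff_norm_tendsto_zero]
    have h := (tendsto_rpow_neg_atTop (sub_pos.2 hs)).comp tendsto_natCast_atTop_atTop
    refine h.congr' ?_
    filter_upwards [eventually_ge_atTop 1] with N hN
    rw [Complex.norm_natCast_cpow_of_pos (by omega)]
    simp
  have hlim : Tendsto (fun N : ℕ => zetaTruncation N s - s * fractIntegral N s) atTop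
      (𝓝 (riemannZeta s - (0 - 1) / (1 - s) - s * 0)) := by
    refine ((hsum.sub ((hpow.sub_const 1).div_const (1 - s))).congr' ?_).sub
      ((tendsto_fractIntegral hs0).const_mul s)
    filter_upwards [eventually_ge_atTop 1] with N hN
    rw [zetaTruncation_eq hN hs1]
  have hconst := tendsto_nhds_unique (hlim.congr' (by
    filter_upwards [eventually_ge_atTop 1] with N hN
    exact zetaTruncation_sub_eq hN hs1 hs0)) tendsto_const_nhds
  rw [← hconst]
  have h2 : s - 1 ≠ 0 := sub_ne_zero.2 hs1
  rw [← neg_sub s 1]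
  field_simp
  ring

theorem zetaTruncation_one (s : ℂ) : zetaTruncation 1 s = 1 := by
  simp [zetaTruncation]

/-- The truncation formula for `ζ` on the right half-plane away from the real axis. -/
theorem riemannZeta_sub_eq {N : ℕ} (hN : 1 ≤ N) {s : ℂ} (hs : 0 < s.re) (him : s.im ≠ 0) :
    riemannZeta s - 1 / (s - 1) = zetaTruncation N s - s * fractIntegral N s := by
  have hs1 : s ≠ 1 := fun h => by simp [h] at him
  rw [zetaTruncation_sub_eq hN hs1 hs, zetaTruncation_one]
  set c := s.im with hc
  -- The open quadrant containing s. It is convex, avoids the pole at 1, and meets the half-plane Re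
  -- z > 1 where the identity is already known, so analytic continuation applies.
  set U : Set ℂ := {z | 0 < z.re} ∩ {z | 0 < c * z.im} with hU
  have hUo : IsOpen U := (isOpen_lt continuous_const Complex.continuous_re).inter
    (isOpen_lt continuous_const (continuous_const.mul Complex.continuous_im))
  have hUc : Convex ℝ U := by
    refine (convex_halfSpace_re_gt 0).inter ?_
    have : {z : ℂ | 0 < c * z.im} = {z : ℂ | 0 < (c • Complex.imLm) z} := rfl
    rw [this]
    exact convex_halfSpace_gt (c • Complex.imLm).isLinear 0
  have hU1 : ∀ z ∈ U, z ≠ 1 := fun z hz h => by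
    have := hz.2
    simp [h] at this
  have hf : AnalyticOnNhd ℂ (fun z => riemannZeta z - 1 / (z - 1)) U := by
    refine DifferentiableOn.analyticOnNhd (fun z hz => ?_) hUo
    refine DifferentiableAt.differentiableWithinAt ?_
    exact (differentiableAt_riemannZeta (hU1 z hz)).sub
      ((differentiableAt_const 1).div (differentiableAt_id.sub_const 1)
        (sub_ne_zero.2 (hU1 z hz)))
  have hg : AnalyticOnNhd ℂ (fun z => 1 - z * fractIntegral 1 z) U := by
    refine DifferentiableOn.analyticOnNhd (fun z hz => ?_) hUo
    exact ((differentiableAt_id.mul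
      (differentiableAt_fractIntegral one_pos hz.1)).const_sub 1).differentiableWithinAt
  have hz0 : (2 + c * Complex.I : ℂ) ∈ U := by
    refine ⟨by simp, ?_⟩
    simpa using mul_self_pos.2 him
  have hev : (fun z => riemannZeta z - 1 / (z - 1)) =ᶠ[𝓝 (2 + c * Complex.I : ℂ)]
      fun z => 1 - z * fractIntegral 1 z := by
    have ho : IsOpen {z : ℂ | 1 < z.re} := isOpen_lt continuous_const Complex.continuous_re
    filter_upwards [ho.mem_nhds (by simp : (1 : ℝ) < (2 + c * Complex.I : ℂ).re)] with z hz
    rw [zetaTruncation_eq_of_one_lt_re hz, zetaTruncation_one]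
  exact hf.eqOn_of_preconnected_of_eventuallyEq hg hUc.isPreconnected hz0 hev
    ⟨hs, mul_self_pos.2 him⟩

/-! ### Square integrability of zeta on the critical line -/

section Plancherel

open FourierTransform

/-- The integral transform and the L² transform agree when tested against smooth compactly supported
functions: in both cases the transform can be moved onto the test function. -/
theorem fourier_ae_eq_toLp {φ : ℝ → ℂ} (h1 : Integrable φ) (h2 : MemLp φ 2) :
    𝓕 φ =ᵐ[volume] (𝓕 (h2.toLp φ) : Lp ℂ 2 (volume : Measure ℝ)) := by
  have hc : Continuous (𝓕 φ) := VectorFourier.fourierIntegral_continuous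
    Real.continuous_fourierChar (L := innerₗ ℝ) continuous_inner h1
  refine ae_eq_of_integral_contDiff_smul_eq hc.locallyIntegrable
    ((Lp.memLp _).locallyIntegrable (by norm_num)) fun g hg hgs => ?_
  have hgs' : HasCompactSupport fun x => (g x : ℂ) := hgs.comp_left (g := fun x : ℝ => (x : ℂ)) rfl
  set G := hgs'.toSchwartzMap (Complex.ofRealCLM.contDiff.comp hg) with hG
  have hGa : ∀ x, G x = (g x : ℂ) := fun x => rfl
  have hL : ∫ x, G x • (𝓕 (h2.toLp φ) : Lp ℂ 2 (volume : Measure ℝ)) x = ∫ x, (𝓕 G) x • φ x := by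
    rw [← Lp.toTemperedDistribution_apply, ← Lp.fourier_toTemperedDistribution_eq,
      TemperedDistribution.fourier_apply, Lp.toTemperedDistribution_apply]
    refine integral_congr_ae ?_
    filter_upwards [h2.coeFn_toLp] with x hx
    rw [hx]
  have hR : ∫ x, (𝓕 G) x • φ x = ∫ x, G x • 𝓕 φ x := by
    rw [SchwartzMap.fourier_coe]
    simpa using! VectorFourier.integral_fourierIntegral_smul_eq_flip (L := innerₗ ℝ)
      Real.continuous_fourierChar continuous_inner G.integrable h1
  have := hL.trans hR
  simp only [hGa, smul_eq_mul] at this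
  simp only [Complex.real_smul]
  exact this.symm

/-- Plancherel's theorem for a function in `L¹ ∩ L²`. -/
theorem memLp_fourier_and_integral_eq {φ : ℝ → ℂ} (h1 : Integrable φ) (h2 : MemLp φ 2) :
    MemLp (𝓕 φ) 2 ∧ ∫ x, ‖𝓕 φ x‖ ^ 2 = ∫ x, ‖φ x‖ ^ 2 := by
  have hae := fourier_ae_eq_toLp h1 h2
  refine ⟨(memLp_congr_ae hae).2 (Lp.memLp _), ?_⟩
  have hn := Lp.norm_fourier_eq (h2.toLp φ)
  have h3 : ∀ f : Lp ℂ 2 (volume : Measure ℝ), ∫ x, ‖f x‖ ^ 2 = ‖f‖ ^ 2 := by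
    intro f
    have h := @inner_self_eq_norm_sq ℂ (Lp ℂ 2 (volume : Measure ℝ)) _ _ _ f
    rw [← h, L2.inner_def, ← integral_re (L2.integrable_inner f f)]
    refine integral_congr_ae (ae_of_all _ fun x => ?_)
    simp only
    rw [inner_self_eq_norm_sq (𝕜 := ℂ)]
  have h4 : ∫ x, ‖𝓕 φ x‖ ^ 2 = ‖(𝓕 (h2.toLp φ) : Lp ℂ 2 (volume : Measure ℝ))‖ ^ 2 := by
    rw [← h3]
    exact integral_congr_ae (hae.mono fun x hx => by simp only [hx])
  have h5 : ∫ x, ‖φ x‖ ^ 2 = ‖h2.toLp φ‖ ^ 2 := by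
    rw [← h3]
    exact integral_congr_ae (h2.coeFn_toLp.mono fun x hx => by simp only [hx])
  rw [h4, h5, hn]

/-- The function whose Fourier transform is `fractIntegral` on the critical line. -/
noncomputable def fractKernel (a : ℝ) (u : ℝ) : ℂ := Real.exp (1 / 2 * u) • fractTail a (Real.exp (-u))

theorem fractIntegral_eq_fourier (a t : ℝ) :
    fractIntegral a (1 / 2 + Complex.I * t) = 𝓕 (fractKernel a) (-(2 * Real.pi)⁻¹ * t) := by
  rw [fractIntegral, mellin_eq_fourier]
  have h1 : -(-(1 / 2 + Complex.I * t) : ℂ).re = 1 / 2 := by simp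
  have h2 : (-(1 / 2 + Complex.I * t) : ℂ).im / (2 * Real.pi) = -(2 * Real.pi)⁻¹ * t := by
    simp only [Complex.neg_im, Complex.add_im, Complex.mul_im, Complex.I_re, Complex.I_im,
      Complex.ofReal_re, Complex.ofReal_im]
    simp
    ring
  rw [h1, h2]
  rfl

theorem norm_fractKernel_le {a : ℝ} (ha : 0 < a) (u : ℝ) :
    ‖fractKernel a u‖ ≤ (Set.Iic (-Real.log a)).indicator (fun u => Real.exp (1 / 2 * u)) u := by
  by_cases hu : u ≤ -Real.log a
  · rw [Set.indicator_of_mem (Set.mem_Iic.2 hu), fractKernel, norm_smul, Real.norm_eq_abs,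
      abs_of_pos (Real.exp_pos _)]
    exact mul_le_of_le_one_right (Real.exp_pos _).le (norm_fractTail_le _ _)
  · rw [Set.indicator_of_notMem (by simpa using hu), fractKernel, fractTail,
      Set.indicator_of_notMem, smul_zero, norm_zero]
    simp only [Set.mem_Ioi, not_lt]
    rw [← Real.exp_log ha]
    exact Real.exp_le_exp.2 (by linarith)

theorem measurable_fractKernel (a : ℝ) : Measurable (fractKernel a) := by
  have h : Measurable fun u : ℝ => Real.exp (1 / 2 * u) := by fun_prop
  exact h.smul ((measurable_fractTail a).comp (by fun_prop))

theorem integrable_fractKernel {a : ℝ} (ha : 0 < a) : Integrable (fractKernel a) := by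
  have h : IntegrableOn (fun u : ℝ => Real.exp (1 / 2 * u)) (Set.Iic (-Real.log a)) :=
    integrableOn_exp_mul_Iic (by norm_num) _
  exact ((integrable_indicator_iff measurableSet_Iic).2 h).mono'
    (measurable_fractKernel a).aestronglyMeasurable (ae_of_all _ (norm_fractKernel_le ha))

theorem norm_sq_fractKernel_le {a : ℝ} (ha : 0 < a) (u : ℝ) :
    ‖fractKernel a u‖ ^ 2 ≤ (Set.Iic (-Real.log a)).indicator Real.exp u := by
  have h := pow_le_pow_left₀ (norm_nonneg _) (norm_fractKernel_le ha u) 2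
  refine h.trans_eq ?_
  by_cases hu : u ∈ Set.Iic (-Real.log a)
  · rw [Set.indicator_of_mem hu, Set.indicator_of_mem hu, ← Real.exp_nat_mul]
    congr 1
    push_cast
    ring
  · rw [Set.indicator_of_notMem hu, Set.indicator_of_notMem hu]
    norm_num

theorem integrable_norm_sq_fractKernel {a : ℝ} (ha : 0 < a) :
    Integrable fun u => ‖fractKernel a u‖ ^ 2 :=
  ((integrable_indicator_iff measurableSet_Iic).2 (integrableOn_exp_Iic _)).mono'
    ((measurable_fractKernel a).norm.pow_const 2).aestronglyMeasurable
    (ae_of_all _ fun u => by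
      rw [Real.norm_eq_abs, abs_of_nonneg (by positivity)]
      exact norm_sq_fractKernel_le ha u)

theorem integral_norm_sq_fractKernel_le {a : ℝ} (ha : 0 < a) :
    ∫ u, ‖fractKernel a u‖ ^ 2 ≤ 1 / a := by
  have h := integral_mono (integrable_norm_sq_fractKernel ha)
    ((integrable_indicator_iff measurableSet_Iic).2 (integrableOn_exp_Iic (-Real.log a)))
    (norm_sq_fractKernel_le ha)
  rwa [integral_indicator measurableSet_Iic, integral_exp_Iic, Real.exp_neg, Real.exp_log ha,
    ← one_div] at h

/-- The factor |s|² cancels the denominator of the density of μ. What is left is the L² norm of a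
Fourier transform, so Plancherel gives ∫_a^∞ {x}² x^{-2} dx ≤ 1/a; the scaling by 2π cancels the
constant 1/(2π). -/
theorem memLp_mul_fractIntegral {a : ℝ} (ha : 0 < a) :
    MemLp (fun t : ℝ => (1 / 2 + Complex.I * t) * fractIntegral a (1 / 2 + Complex.I * t)) 2 mu ∧
    ∫ t : ℝ, ‖(1 / 2 + Complex.I * t) * fractIntegral a (1 / 2 + Complex.I * t)‖ ^ 2 ∂mu
      ≤ 1 / a := by
  have hpi := Real.pi_pos
  have h1 := integrable_fractKernel ha
  have h2 : MemLp (fractKernel a) 2 :=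
    (memLp_two_iff_integrable_sq_norm h1.aestronglyMeasurable).2 (integrable_norm_sq_fractKernel ha)
  obtain ⟨h3, h4⟩ := memLp_fourier_and_integral_eq h1 h2
  have hc : Continuous (𝓕 (fractKernel a)) := VectorFourier.fourierIntegral_continuous
    Real.continuous_fourierChar (L := innerₗ ℝ) continuous_inner h1
  simp only [fractIntegral_eq_fourier]
  have h5 := (memLp_two_iff_integrable_sq_norm h3.aestronglyMeasurable).1 h3
  have hr : (-(2 * Real.pi)⁻¹ : ℝ) ≠ 0 := by
    simp
  have hpt : ∀ t : ℝ, (1 / (2 * Real.pi) * (1 / (1 / 4 + t ^ 2))) •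
      ‖(1 / 2 + Complex.I * t) * 𝓕 (fractKernel a) (-(2 * Real.pi)⁻¹ * t)‖ ^ 2
      = (2 * Real.pi)⁻¹ * ‖𝓕 (fractKernel a) (-(2 * Real.pi)⁻¹ * t)‖ ^ 2 := by
    intro t
    have hn : ‖(1 / 2 + Complex.I * t : ℂ)‖ ^ 2 = 1 / 4 + t ^ 2 := by
      rw [← Complex.normSq_eq_norm_sq, Complex.normSq_apply]
      simp
      ring
    have h0 : 1 / 4 + t ^ 2 ≠ 0 := by positivity
    rw [norm_mul, mul_pow, hn, smul_eq_mul]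
    field_simp
  have hm : AEStronglyMeasurable (fun t : ℝ =>
      (1 / 2 + Complex.I * t) * 𝓕 (fractKernel a) (-(2 * Real.pi)⁻¹ * t)) mu :=
    Continuous.aestronglyMeasurable (by fun_prop)
  refine ⟨(memLp_two_iff_integrable_sq_norm hm).2 ?_, ?_⟩
  · rw [integrable_mu_iff]
    simp only [hpt]
    exact (h5.comp_mul_left' hr).const_mul _
  · rw [integral_mu]
    simp only [hpt]
    rw [integral_const_mul, Measure.integral_comp_mul_left
      (fun x => ‖𝓕 (fractKernel a) x‖ ^ 2) (-(2 * Real.pi)⁻¹), h4, inv_neg, inv_inv, abs_neg,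
      abs_of_pos (by positivity), smul_eq_mul, ← mul_assoc, inv_mul_cancel₀ (by positivity), one_mul]
    exact integral_norm_sq_fractKernel_le ha

end Plancherel

/-! ### Fourier coefficients of the regular part of zeta, as limits of Stieltjes sequences -/

/-- The regular part of zeta on the critical line. -/
noncomputable def regularZeta (t : ℝ) : ℂ :=
  riemannZeta (1 / 2 + Complex.I * t) - 1 / (1 / 2 + Complex.I * t - 1)

theorem ae_zetaTruncation_eq {N : ℕ} (hN : 1 ≤ N) :
    ∀ᵐ t : ℝ ∂mu, zetaTruncation N (1 / 2 + Complex.I * t) = regularZeta t +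
      (1 / 2 + Complex.I * t) * fractIntegral N (1 / 2 + Complex.I * t) := by
  have h0 : ∀ᵐ t : ℝ ∂mu, t ≠ 0 :=
    mu_absolutelyContinuous_volume.ae_le (Measure.ae_ne volume (0 : ℝ))
  filter_upwards [h0] with t ht
  rw [regularZeta, riemannZeta_sub_eq hN (by simp) (by simpa using ht)]
  ring

theorem memLp_regularZeta : MemLp regularZeta 2 mu := by
  have h : MemLp (fun t : ℝ => 1 -
      (1 / 2 + Complex.I * t) * fractIntegral (1 : ℕ) (1 / 2 + Complex.I * t)) 2 mu :=
    (memLp_const 1).sub (memLp_mul_fractIntegral (by norm_num)).1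
  refine (memLp_congr_ae ?_).1 h
  filter_upwards [ae_zetaTruncation_eq le_rfl] with t ht
  rw [zetaTruncation_one] at ht
  linear_combination ht

theorem fourierCoefficient_sub {f g : ℝ → ℂ} (hf : Integrable f mu) (hg : Integrable g mu) (n : ℤ) :
    fourierCoefficient (fun t => f t - g t) n = fourierCoefficient f n - fourierCoefficient g n := by
  have h : ∀ {f : ℝ → ℂ}, Integrable f mu → Integrable (fun t => f t * e (-n) t) mu := fun hf =>
    hf.mul_bdd (c := 1) (continuous_e _).aestronglyMeasurable
      (ae_of_all _ fun t => (norm_e _ t).le)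
  simp only [fourierCoefficient, conj_e, sub_mul]
  exact integral_sub (h hf) (h hg)

theorem norm_fourierCoefficient_le {f : ℝ → ℂ} (hf : MemLp f 2 mu) {δ : ℝ} (hδ : 0 < δ)
    (h : ∫ t, ‖f t‖ ^ 2 ∂mu ≤ δ ^ 2) (n : ℤ) : ‖fourierCoefficient f n‖ ≤ δ := by
  have hi := (memLp_two_iff_integrable_sq_norm hf.aestronglyMeasurable).1 hf
  -- The pointwise inequality 2‖f‖ ≤ δ + δ⁻¹‖f‖² takes the place of Cauchy–Schwarz.
  have h1 : ‖fourierCoefficient f n‖ ≤ ∫ t, ((δ + δ⁻¹ * ‖f t‖ ^ 2) / 2) ∂mu := by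
    refine norm_integral_le_of_norm_le (((integrable_const δ).add (hi.const_mul δ⁻¹)).div_const 2)
      (ae_of_all _ fun t => ?_)
    rw [conj_e, norm_mul, norm_e, mul_one, le_div_iff₀ two_pos]
    have h2 : 0 ≤ δ⁻¹ * (‖f t‖ - δ) ^ 2 := by positivity
    have h3 : δ⁻¹ * (‖f t‖ - δ) ^ 2 = δ⁻¹ * ‖f t‖ ^ 2 - 2 * ‖f t‖ + δ := by
      field_simp
      ring
    linarith
  refine h1.trans ?_
  rw [integral_div, integral_add (integrable_const δ) (hi.const_mul δ⁻¹), integral_const_mul]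
  simp only [integral_const, probReal_univ, one_smul]
  have h4 : δ⁻¹ * ∫ t, ‖f t‖ ^ 2 ∂mu ≤ δ⁻¹ * δ ^ 2 := by gcongr
  have h5 : δ⁻¹ * δ ^ 2 = δ := by field_simp
  linarith

theorem tendsto_fourierCoefficient_zetaTruncation (n : ℤ) :
    Tendsto (fun N : ℕ => fourierCoefficient
      (fun t => zetaTruncation N (1 / 2 + Complex.I * t)) n) atTop
      (𝓝 (fourierCoefficient regularZeta n)) := by
  have hlim : Tendsto (fun N : ℕ => 1 / Real.sqrt N) atTop (𝓝 0) := by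
    simp only [one_div]
    exact (Real.tendsto_sqrt_atTop.comp tendsto_natCast_atTop_atTop).inv_tendsto_atTop
  rw [tendsto_iff_norm_sub_tendsto_zero]
  refine squeeze_zero' (Eventually.of_forall fun _ => norm_nonneg _) ?_ hlim
  filter_upwards [eventually_ge_atTop 1] with N hN
  have hN0 : (0 : ℝ) < N := by exact_mod_cast hN
  obtain ⟨h1, h2⟩ := memLp_mul_fractIntegral hN0
  have hsum : Integrable (fun t : ℝ => zetaTruncation N (1 / 2 + Complex.I * t)) mu :=
    ((memLp_regularZeta.add h1).integrable one_le_two).congr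
      ((ae_zetaTruncation_eq hN).mono fun t ht => ht.symm)
  rw [← fourierCoefficient_sub hsum (memLp_regularZeta.integrable one_le_two)]
  have hcongr : fourierCoefficient
      (fun t => zetaTruncation N (1 / 2 + Complex.I * t) - regularZeta t) n
      = fourierCoefficient (fun t : ℝ =>
        (1 / 2 + Complex.I * t) * fractIntegral N (1 / 2 + Complex.I * t)) n := by
    refine integral_congr_ae ?_
    filter_upwards [ae_zetaTruncation_eq hN] with t ht
    rw [ht]
    ring
  rw [hcongr]
  refine norm_fourierCoefficient_le h1 (by positivity) (h2.trans_eq ?_) n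
  rw [div_pow, Real.sq_sqrt hN0.le, one_pow]

/-- Rests on m^{-s} = m^{-1} exp((1 - s) log m) and Fubini. A monomial u^k in `expCoeff n` turns the
right side into the k-th Stieltjes sequence. -/
theorem fourierCoefficient_zetaTruncation (N : ℕ) (n : ℤ) :
    fourierCoefficient (fun t => zetaTruncation N (1 / 2 + Complex.I * t)) n
      = ∑ m ∈ Finset.Icc 1 N, (1 / (m : ℂ)) * expCoeff n (Real.log m) -
        ∫ v in (0 : ℝ)..Real.log N, expCoeff n v := by
  have hre : ∀ t : ℝ, |(1 / 2 - Complex.I * t : ℂ).re| ≤ 1 / 2 := fun t => by simp [abs_of_pos]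
  have hcont : Continuous fun t : ℝ => (1 / 2 - Complex.I * t : ℂ) := by fun_prop
  have hprod := integrable_prod_exp hcont (continuous_e (-n)) hre (fun t => (norm_e _ t).le) 0
    (Real.log N)
  have hterm : ∀ m ∈ Finset.Icc 1 N, ∀ t : ℝ, (m : ℂ) ^ (-(1 / 2 + Complex.I * t))
      = (1 / (m : ℂ)) * Complex.exp ((1 / 2 - Complex.I * t) * Real.log m) := by
    intro m hm t
    have hm0 : (m : ℂ) ≠ 0 := by
      have := (Finset.mem_Icc.1 hm).1
      exact_mod_cast (by omega : m ≠ 0)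
    rw [show (-(1 / 2 + Complex.I * t) : ℂ) = (1 / 2 - Complex.I * t) - 1 by ring,
      Complex.cpow_sub _ _ hm0, Complex.cpow_one, Complex.cpow_def_of_ne_zero hm0,
      Complex.natCast_log, mul_comm (Complex.log _)]
    ring
  have hpt : ∀ t : ℝ, zetaTruncation N (1 / 2 + Complex.I * t) * e (-n) t
      = ∑ m ∈ Finset.Icc 1 N, (1 / (m : ℂ)) *
          (Complex.exp ((1 / 2 - Complex.I * t) * Real.log m) * e (-n) t) -
        ∫ v in (0 : ℝ)..Real.log N, Complex.exp ((1 / 2 - Complex.I * t) * v) * e (-n) t := by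
    intro t
    rw [zetaTruncation, sub_mul, Finset.sum_mul, intervalIntegral.integral_mul_const]
    congr 1
    · exact Finset.sum_congr rfl fun m hm => by rw [hterm m hm t, mul_assoc]
    · congr 3
      ext v
      congr 2
      ring
  have hi : ∀ m : ℕ, Integrable (fun t : ℝ =>
      Complex.exp ((1 / 2 - Complex.I * t) * Real.log m) * e (-n) t) mu := fun m =>
    integrable_of_continuous_of_bound
      (Continuous.mul (by fun_prop) (continuous_e _)) fun t => by
        rw [norm_mul, norm_e, mul_one]
        exact norm_exp_mul_le (hre t) _
  have hi2 : Integrable (fun t : ℝ => ∫ v in (0 : ℝ)..Real.log N,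
      Complex.exp ((1 / 2 - Complex.I * t) * v) * e (-n) t) mu := by
    simp only [intervalIntegral.intervalIntegral_eq_integral_uIoc]
    exact hprod.integral_prod_right.smul _
  simp only [fourierCoefficient, conj_e, hpt]
  rw [integral_sub (integrable_finsetSum _ fun m _ => (hi m).const_mul _) hi2,
    integral_finsetSum _ fun m _ => (hi m).const_mul _, ← intervalIntegral_integral_swap hprod]
  simp only [integral_const_mul]
  rfl

theorem fourierCoefficient_zetaTruncation_neg (N n : ℕ) :
    fourierCoefficient (fun t => zetaTruncation N (1 / 2 + Complex.I * t)) (-(n + 1 : ℕ)) = 0 := by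
  rw [fourierCoefficient_zetaTruncation, Finset.sum_eq_zero fun m _ => by
    rw [expCoeff_neg n (Real.log_natCast_nonneg m), mul_zero], intervalIntegral.integral_congr
    (g := fun _ => (0 : ℂ))]
  · simp
  · intro v hv
    rw [Set.uIcc_of_le (Real.log_natCast_nonneg N)] at hv
    exact expCoeff_neg n hv.1

theorem fourierCoefficient_zetaTruncation_zero (N : ℕ) :
    fourierCoefficient (fun t => zetaTruncation N (1 / 2 + Complex.I * t)) 0
      = stieltjesSeq 0 N := by
  have h1 : ∫ v in (0 : ℝ)..Real.log N, expCoeff 0 v = ∫ v in (0 : ℝ)..Real.log N, (1 : ℂ) := by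
    refine intervalIntegral.integral_congr fun v hv => ?_
    rw [Set.uIcc_of_le (Real.log_natCast_nonneg N)] at hv
    exact expCoeff_zero hv.1
  rw [fourierCoefficient_zetaTruncation, h1, stieltjesSeq, Finset.sum_congr rfl fun m _ => by
    rw [expCoeff_zero (Real.log_natCast_nonneg m), mul_one]]
  simp

theorem fourierCoefficient_zetaTruncation_pos (N n : ℕ) :
    fourierCoefficient (fun t => zetaTruncation N (1 / 2 + Complex.I * t)) (n + 1 : ℕ)
      = ∑ j ∈ Finset.range (n + 1), (n.choose j : ℂ) * (-1) ^ (n + j) *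
        (stieltjesSeq (j + 1) N / ((j + 1).factorial : ℂ)) := by
  have h1 : ∫ v in (0 : ℝ)..Real.log N, expCoeff (n + 1 : ℕ) v
      = ∑ j ∈ Finset.range (n + 1), (n.choose j : ℂ) * (-1) ^ (n + j) *
        ((Real.log N : ℂ) ^ (j + 2) / (j + 2) / ((j + 1).factorial : ℂ)) := by
    rw [intervalIntegral.integral_congr (g := fun v : ℝ => ∑ j ∈ Finset.range (n + 1),
      (n.choose j : ℂ) * (-1) ^ (n + j) * ((v : ℂ) ^ (j + 1) / ((j + 1).factorial : ℂ)))]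
    · rw [intervalIntegral.integral_finsetSum fun j _ =>
        Continuous.intervalIntegrable (by fun_prop) _ _]
      refine Finset.sum_congr rfl fun j _ => ?_
      rw [intervalIntegral.integral_const_mul, intervalIntegral.integral_div, integral_ofReal_pow]
      push_cast
      ring
    · intro v hv
      rw [Set.uIcc_of_le (Real.log_natCast_nonneg N)] at hv
      exact expCoeff_pos n hv.1
  rw [fourierCoefficient_zetaTruncation, h1, Finset.sum_congr rfl fun m _ => by
    rw [expCoeff_pos n (Real.log_natCast_nonneg m), Finset.mul_sum], Finset.sum_comm,
    ← Finset.sum_sub_distrib]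
  refine Finset.sum_congr rfl fun j _ => ?_
  rw [stieltjesSeq]
  push_cast
  rw [sub_div, mul_sub, Finset.sum_div, Finset.mul_sum]
  congr 1
  · exact Finset.sum_congr rfl fun m _ => by ring
  · ring

theorem ell_succ (n : ℕ) : (ell (n + 1) : ℂ) = ∑ j ∈ Finset.range (n + 1),
    (n.choose j : ℂ) * (-1) ^ (n + j) *
      ((stieltjesConstant (j + 1) : ℂ) / ((j + 1).factorial : ℂ)) := by
  rw [ell, if_neg n.succ_ne_zero, Finset.range_eq_Ico]
  have h := Finset.sum_Ico_add' (fun k => (((n + 1 - 1).choose (k - 1) : ℝ) *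
    ((-1) ^ k * stieltjesConstant k / (k.factorial : ℝ)))) 0 (n + 1) 1
  rw [show Finset.Icc 1 (n + 1) = Finset.Ico (0 + 1) (n + 1 + 1) by ext; simp, ← h]
  push_cast
  rw [Finset.mul_sum]
  refine Finset.sum_congr rfl fun j _ => ?_
  have : ((-1) ^ (n + 1) * (-1) ^ (j + 1) : ℂ) = (-1) ^ (n + j) := by
    rw [pow_succ, pow_succ, pow_add]; ring
  rw [← this]
  ring

theorem fourierCoefficient_regularZeta_neg (n : ℕ) :
    fourierCoefficient regularZeta (-(n + 1 : ℕ)) = 0 := by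
  have h := tendsto_fourierCoefficient_zetaTruncation (-(n + 1 : ℕ))
  simp only [fourierCoefficient_zetaTruncation_neg] at h
  exact tendsto_nhds_unique h tendsto_const_nhds

theorem fourierCoefficient_regularZeta_zero :
    fourierCoefficient regularZeta 0 = stieltjesConstant 0 := by
  have h := tendsto_fourierCoefficient_zetaTruncation 0
  simp only [fourierCoefficient_zetaTruncation_zero] at h
  exact tendsto_nhds_unique h ((Complex.continuous_ofReal.tendsto _).comp (tendsto_stieltjesSeq 0))

theorem fourierCoefficient_regularZeta_pos (n : ℕ) :
    fourierCoefficient regularZeta (n + 1 : ℕ) = ell (n + 1) := by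
  have h := tendsto_fourierCoefficient_zetaTruncation (n + 1 : ℕ)
  simp only [fourierCoefficient_zetaTruncation_pos] at h
  rw [ell_succ]
  refine tendsto_nhds_unique h (tendsto_finsetSum _ fun j _ => Tendsto.const_mul _ ?_)
  exact ((Complex.continuous_ofReal.tendsto _).comp (tendsto_stieltjesSeq (j + 1))).div_const _

/-! ### Fourier coefficients of zeta on the critical line and the limit value -/

/-- The zeta function on the critical line. -/
noncomputable def criticalZeta (t : ℝ) : ℂ := riemannZeta (1 / 2 + Complex.I * t)

/-- On the critical line the polar part 1/(s - 1) = -1/(1/2 - it) is a combination of two basis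
functions. -/
theorem criticalZeta_eq (t : ℝ) : criticalZeta t = regularZeta t - (e (-1) t + e 0 t) := by
  rw [criticalZeta, regularZeta, e_neg_one, e_zero, div_add_one (half_sub_ne_zero t)]
  rw [show (1 / 2 + Complex.I * t - 1 : ℂ) = -(1 / 2 - Complex.I * t) by ring, div_neg]
  ring

theorem memLp_criticalZeta : MemLp criticalZeta 2 mu := by
  have h := memLp_regularZeta.sub ((memLp_e (-1)).add (memLp_e 0))
  have : criticalZeta = regularZeta - (e (-1) + e 0) := funext criticalZeta_eq
  rwa [this]

theorem fourierCoefficient_criticalZeta (n : ℤ) : fourierCoefficient criticalZeta n =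
    fourierCoefficient regularZeta n -
      ((if n = -1 then 1 else 0) + if n = 0 then 1 else 0) := by
  have i1 := (memLp_e (-1)).integrable one_le_two
  have i0 := (memLp_e 0).integrable one_le_two
  have ir := memLp_regularZeta.integrable one_le_two
  have h : criticalZeta = fun t => (regularZeta - e (-1)) t - e 0 t := by
    ext t
    rw [criticalZeta_eq, Pi.sub_apply]
    ring
  rw [h, fourierCoefficient_sub (ir.sub i1) i0, fourierCoefficient_e]
  have h2 := fourierCoefficient_sub ir i1 n
  rw [fourierCoefficient_e] at h2
  rw [show regularZeta - e (-1) = fun t => regularZeta t - e (-1) t from rfl, h2]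
  ring

theorem fourierCoefficient_criticalZeta_nat (m : ℕ) :
    fourierCoefficient criticalZeta m = ell m := by
  rw [fourierCoefficient_criticalZeta]
  rcases m with _ | m
  · simp [fourierCoefficient_regularZeta_zero, ell]
  · rw [fourierCoefficient_regularZeta_pos, if_neg (by omega), if_neg (by omega)]
    ring

theorem fourierCoefficient_criticalZeta_neg (m : ℕ) :
    fourierCoefficient criticalZeta (-(m + 1 : ℤ)) = if m = 0 then -1 else 0 := by
  have h := fourierCoefficient_regularZeta_neg m
  push_cast at h
  rw [fourierCoefficient_criticalZeta, h]
  by_cases hm : m = 0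
  · simp [hm]
  · have h1 : ¬(-(m + 1 : ℤ) = -1) := by omega
    have h2 : ¬(-(m + 1 : ℤ) = 0) := by omega
    rw [if_neg h1, if_neg h2, if_neg hm]
    ring

/-- The nonnegative half of Parseval's series over ℤ; in ℂ, `Summable` amounts to absolute
convergence. -/
theorem summable_ell_mul {g : ℝ → ℂ} (hg : MemLp g 2 mu) :
    Summable fun m : ℕ => (ell m : ℂ) * fourierCoefficient g (-(m : ℤ)) := by
  have h := (hasSum_fourierCoefficient_mul memLp_criticalZeta hg).summable.comp_injective
    (Nat.cast_injective (R := ℤ))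
  refine h.congr fun m => ?_
  simp only [Function.comp_apply]
  rw [fourierCoefficient_criticalZeta_nat]

theorem integral_criticalZeta_mul {g : ℝ → ℂ} (hg : MemLp g 2 mu) :
    ∫ t, criticalZeta t * g t ∂mu = -fourierCoefficient g 1 +
      ∑' m : ℕ, (ell m : ℂ) * fourierCoefficient g (-(m : ℤ)) := by
  have h1 : HasSum (fun m : ℕ => fourierCoefficient criticalZeta m *
      fourierCoefficient g (-(m : ℤ))) (∑' m : ℕ, (ell m : ℂ) * fourierCoefficient g (-(m : ℤ))) := by
    simp only [fourierCoefficient_criticalZeta_nat]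
    exact (summable_ell_mul hg).hasSum
  have h2 : HasSum (fun m : ℕ => fourierCoefficient criticalZeta (-(m + 1 : ℤ)) *
      fourierCoefficient g (-(-(m + 1 : ℤ)))) (-fourierCoefficient g 1) := by
    refine (hasSum_ite_eq (0 : ℕ) (-fourierCoefficient g 1)).congr_fun fun m => ?_
    rw [fourierCoefficient_criticalZeta_neg]
    by_cases hm : m = 0
    · simp [hm]
    · simp [hm]
  rw [add_comm]
  exact (hasSum_fourierCoefficient_mul memLp_criticalZeta hg).unique
    (h1.of_nat_of_neg_add_one h2)

end ZetaBoole

theorem mainTheorem11 (g : ℝ → ℂ) (hg : MemLp g 2 ZetaBoole.mu) :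
    Summable (fun m : ℕ =>
      (ZetaBoole.ell m : ℂ) * ZetaBoole.fourierCoefficient g (-(m : ℤ))) ∧
    ∀ᵐ x : ℝ, Tendsto
      (fun N : ℕ => (1 / (N : ℂ)) * ∑ n ∈ Finset.range N,
        riemannZeta (1 / 2 + Complex.I * (ZetaBoole.boole^[n] x : ℝ)) *
          g (ZetaBoole.boole^[n] x))
      atTop
      (𝓝 (-ZetaBoole.fourierCoefficient g 1 +
        ∑' m : ℕ, (ZetaBoole.ell m : ℂ) * ZetaBoole.fourierCoefficient g (-(m : ℤ)))) := by
  refine ⟨ZetaBoole.summable_ell_mul hg, ?_⟩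
  rw [← ZetaBoole.integral_criticalZeta_mul hg]
  exact ZetaBoole.ae_tendsto_average_boole (F := fun t => ZetaBoole.criticalZeta t * g t)
    (ZetaBoole.memLp_criticalZeta.integrable_mul hg)
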